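/- All Hilbert spaces are finite-dimensional and nonzero, and $\log$ is to base $2$ with $-\log 0=+\infty$. Let $\mathcal N,\mathcal M$ be completely positive trace-preserving maps from operators on $A$ to operators on $B$, and let the Choi matrix of $\mathcal N$ be positive definite ($\mathcal N>0$). For density matrices $\rho,\sigma$ on one space put $D(\rho\|\sigma)=\operatorname{tr}[\rho(\log\rho-\log\sigma)]$ if $\operatorname{supp}\rho\subseteq\operatorname{supp}\sigma$ and $D(\rho\|\sigma)=+\infty$ otherwise. For $\varepsilon\in(0,1)$ put $$D_s^\varepsilon(\rho\|\sigma)=\sup\{\gamma\in\mathbb R:\operatorname{tr}(\rho\{\rho\le 2^\gamma\sigma\})\le\varepsilon\},$$ $$\underline D_s^\varepsilon(\rho\|\sigma)=\sup\{\gamma\in\mathbb R:\operatorname{tr}(\rho-2^\gamma\sigma)_+\ge 1-\varepsilon\},\qquad \overline D_s^\varepsilon(\rho\|\sigma)=\inf\{\gamma\in\mathbb R:\operatorname{tr}(\rho-2^\gamma\sigma)_+\le\varepsilon\},$$ where $X_+$ is the positive part of $X$ and $\{X\le Y\}$ is the projector onto the positive part of $Y-X$ (the span of the eigenvectors with positive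 eigenvalue). Let $$D_{\max}^\varepsilon(\rho\|\sigma)=\inf_{\rho'}D_{\max}(\rho'\|\sigma),\qquad D_{\max}(\rho'\|\sigma)=\log\inf\{t\in\mathbb R:\rho'\le t\sigma\}$$ if $\operatorname{supp}\rho'\subseteq\operatorname{supp}\sigma$ and $D_{\max}(\rho'\|\sigma)=+\infty$ otherwise, where the infimum is over all $\rho'\ge0$ with $\operatorname{tr}\rho'\le1$ and $\sqrt{1-F(\rho',\rho)^2}\le\varepsilon$, with $F(\rho',\rho)=\|\sqrt{\rho'}\sqrt{\rho}\|_1+\sqrt{(1-\operatorname{tr}\rho')(1-\operatorname{tr}\rho)}$. Any such quantity $\boldsymbol D$ is extended to channels by $\boldsymbol D(\mathcal N\|\mathcal M)=\sup_{\psi}\boldsymbol D\big((\mathrm{id}_R\otimes\mathcal N)(\psi)\,\big\|\,(\mathrm{id}_R\otimes\mathcal M)(\psi)\big)$, the supremum being over all density matrices $\psi$ on $R\otimes A$ with $R$ of arbitrary finite dimension. Put $D^{\rm reg}(\mathcal N\|\mathcal M)=\sup_{n\ge1}\frac1n D(\mathcal N^{\otimes n}\|\mathcal M^{\otimes n})$.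 Assume that the exponentially strong converse holds for $(\mathcal N,\mathcal M)$ (it is conjectured to hold for all such pairs): for every sequence of coherent strategies, i.e. density matrices $\psi_n$ on $R_n\otimes A^{\otimes n}$ and tests $0\le\Pi_n\le I$ on $R_n\otimes B^{\otimes n}$, with errors $\alpha_n=\operatorname{tr}[(I-\Pi_n)(\mathrm{id}\otimes\mathcal N^{\otimes n})(\psi_n)]$ and $\beta_n=\operatorname{tr}[\Pi_n(\mathrm{id}\otimes\mathcal M^{\otimes n})(\psi_n)]$, if $\liminf_{n\to\infty}-\frac1n\log\beta_n>D^{\rm reg}(\mathcal N\|\mathcal M)$, then there is $c>0$ with $1-\alpha_n\le2^{-cn}$ for all sufficiently large $n$. Then for every fixed $\varepsilon\in(0,1)$ and every $\boldsymbol D^\varepsilon\in\{D_{\max}^\varepsilon,\underline D_s^\varepsilon,\overline D_s^\varepsilon,D_s^\varepsilon\}$, $$\lim_{n\to\infty}\frac1n\boldsymbol D^\varepsilon\big(\mathcal N^{\otimes n}\big\|\mathcal M^{\otimes n}\big)=D^{\rm reg}(\mathcal N\|\mathcal M)$$ as an identity in $[-\infty,+\infty]$. -/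

import Mathlib

open Filter Topology
open scoped ComplexOrder

universe u v

noncomputable section

namespace ChannelAEP

/-! Finite-dimensional quantum systems are represented by finite index types of an orthonormal
basis; operators on a system `X` are matrices in `Matrix X X ℂ`. -/

section States

variable {X : Type u} [Fintype X] [DecidableEq X]

/-- Density matrices. -/
def IsDensity (ρ : Matrix X X ℂ) : Prop :=
  ρ.PosSemidef ∧ ρ.trace = 1

/-- Subnormalized states. -/
def IsSubnormalized (ρ : Matrix X X ℂ) : Prop :=
  ρ.PosSemidef ∧ ρ.trace.re ≤ 1

/-- The support of a Hermitian operator, i.e. its range. -/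
def supp (Y : Matrix X X ℂ) : Submodule ℂ (X → ℂ) :=
  LinearMap.range Y.mulVecLin

/-- The positive part `Y₊` of a Hermitian operator. -/
def posPart (Y : Matrix X X ℂ) : Matrix X X ℂ :=
  cfc (fun x : ℝ => max x 0) Y

/-- `{Y ≤ Z}`: the projector onto the positive part of the Hermitian operator `Z - Y`. -/
def projLE (Y Z : Matrix X X ℂ) : Matrix X X ℂ :=
  cfc (fun x : ℝ => if 0 < x then (1 : ℝ) else 0) (Z - Y)

/-- The trace norm `‖Y‖₁ = tr √(Y† Y)`. -/
def traceNorm (Y : Matrix X X ℂ) : ℝ :=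
  (cfc Real.sqrt (Y.conjTranspose * Y)).trace.re

end States

/-- Base-2 logarithm of a nonnegative real, with `log 0 = -∞`. -/
def elog2 (x : ℝ) : EReal :=
  if x ≤ 0 then ⊥ else ((Real.logb 2 x : ℝ) : EReal)

/-- A family of extended-real-valued functions of two operators, one for each finite system. -/
abbrev StateDivergence : Type (u + 1) :=
  ∀ (X : Type u) [Fintype X] [DecidableEq X], Matrix X X ℂ → Matrix X X ℂ → EReal

open Classical in
/-- The Umegaki relative entropy. The functional calculus uses `log 0 = 0`, i.e. logarithms are
taken on the supports. -/
def umegaki : StateDivergence.{u} := fun _ _ _ ρ σ =>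
  if supp ρ ≤ supp σ then
    (((ρ * (cfc (Real.logb 2) ρ - cfc (Real.logb 2) σ)).trace.re : ℝ) : EReal)
  else ⊤

open Classical in
/-- The max-relative entropy. -/
def dMax : StateDivergence.{u} := fun _ _ _ ρ σ =>
  if supp ρ ≤ supp σ then elog2 (sInf {t : ℝ | (t • σ - ρ).PosSemidef}) else ⊤

section Distance

variable {X : Type u} [Fintype X] [DecidableEq X]

/-- The generalized fidelity of subnormalized states. -/
def fidelity (ρ σ : Matrix X X ℂ) : ℝ :=
  traceNorm (cfc Real.sqrt ρ * cfc Real.sqrt σ)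
    + √((1 - ρ.trace.re) * (1 - σ.trace.re))

/-- The purified distance. -/
def purifiedDist (ρ σ : Matrix X X ℂ) : ℝ :=
  √(1 - fidelity ρ σ ^ 2)

end Distance

/-- The smooth max-relative entropy. -/
def dMaxSmooth (ε : ℝ) : StateDivergence.{u} := fun X _ _ ρ σ =>
  ⨅ (ρ' : Matrix X X ℂ) (_ : IsSubnormalized ρ' ∧ purifiedDist ρ' ρ ≤ ε), dMax X ρ' σ

/-- The information spectrum relative entropy `D_s^ε`. -/
def dSpec (ε : ℝ) : StateDivergence.{u} := fun _ _ _ ρ σ =>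
  ⨆ (γ : ℝ) (_ : (ρ * projLE ρ ((2 : ℝ) ^ γ • σ)).trace.re ≤ ε), (γ : EReal)

/-- The lower information spectrum relative entropy. -/
def dSpecLower (ε : ℝ) : StateDivergence.{u} := fun _ _ _ ρ σ =>
  ⨆ (γ : ℝ) (_ : 1 - ε ≤ (posPart (ρ - (2 : ℝ) ^ γ • σ)).trace.re), (γ : EReal)

/-- The upper information spectrum relative entropy. -/
def dSpecUpper (ε : ℝ) : StateDivergence.{u} := fun _ _ _ ρ σ =>
  ⨅ (γ : ℝ) (_ : (posPart (ρ - (2 : ℝ) ^ γ • σ)).trace.re ≤ ε), (γ : EReal)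

section Channels

variable {A : Type u} {B : Type v} [Fintype A] [DecidableEq A] [Fintype B] [DecidableEq B]

/-- The map `id_R ⊗ N` on operators of the composite system `R × A`. -/
def idTensor (R : Type) (N : Matrix A A ℂ →ₗ[ℂ] Matrix B B ℂ)
    (Y : Matrix (R × A) (R × A) ℂ) : Matrix (R × B) (R × B) ℂ :=
  Matrix.of fun p q => N (Matrix.of fun a a' => Y (p.1, a) (q.1, a')) p.2 q.2

/-- Completely positive trace-preserving maps. -/
def IsCPTP (N : Matrix A A ℂ →ₗ[ℂ] Matrix B B ℂ) : Prop :=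
  (∀ (d : ℕ) (Y : Matrix (Fin d × A) (Fin d × A) ℂ),
      Y.PosSemidef → (idTensor (Fin d) N Y).PosSemidef) ∧
    ∀ Y : Matrix A A ℂ, (N Y).trace = Y.trace

/-- The Choi matrix `∑ N(|a⟩⟨a'|) ⊗ |a⟩⟨a'|`. -/
def choi (N : Matrix A A ℂ →ₗ[ℂ] Matrix B B ℂ) : Matrix (B × A) (B × A) ℂ :=
  Matrix.of fun p q => N (Matrix.single p.2 q.2 1) p.1 q.1

/-- The tensor power `N^{⊗n}` on operators of the system `Aⁿ`: the linear map that sends the matrix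
unit `|a₁…aₙ⟩⟨a'₁…a'ₙ|` to `N(|a₁⟩⟨a'₁|) ⊗ ⋯ ⊗ N(|aₙ⟩⟨a'ₙ|)`. -/
def tensorPow (N : Matrix A A ℂ →ₗ[ℂ] Matrix B B ℂ) (n : ℕ) :
    Matrix (Fin n → A) (Fin n → A) ℂ →ₗ[ℂ] Matrix (Fin n → B) (Fin n → B) ℂ where
  toFun Y := Matrix.of fun b b' =>
    ∑ a : Fin n → A, ∑ a' : Fin n → A,
      Y a a' * ∏ i, N (Matrix.single (a i) (a' i) 1) (b i) (b' i)
  map_add' Y Z := by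
    ext b b'
    simp [add_mul, Finset.sum_add_distrib]
  map_smul' c Y := by
    ext b b'
    simp [Finset.mul_sum, mul_assoc]

/-- The channel divergence induced by a state divergence: the supremum over all input states on
`R ⊗ A`, with `R` of arbitrary finite dimension `d`. -/
def channelDiv (D : StateDivergence.{v}) (N M : Matrix A A ℂ →ₗ[ℂ] Matrix B B ℂ) : EReal :=
  ⨆ (d : ℕ) (ψ : Matrix (Fin d × A) (Fin d × A) ℂ) (_ : IsDensity ψ),
    D (Fin d × B) (idTensor (Fin d) N ψ) (idTensor (Fin d) M ψ)

/-- The regularized channel divergence. -/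
def regDiv (D : StateDivergence.{v}) (N M : Matrix A A ℂ →ₗ[ℂ] Matrix B B ℂ) : EReal :=
  ⨆ (n : ℕ) (_ : 1 ≤ n),
    (((1 / n : ℝ)) : EReal) * channelDiv D (tensorPow N n) (tensorPow M n)

end Channels

/-- A coherent discrimination strategy for `n` uses of a channel from `A` to `B`: a reference system
of dimension `d`, an input state on `R ⊗ Aⁿ` and a test on `R ⊗ Bⁿ`. -/
structure CoherentStrategy (A : Type u) (B : Type v) [Fintype A] [DecidableEq A]
    [Fintype B] [DecidableEq B] (n : ℕ) where
  /-- dimension of the reference system -/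
  d : ℕ
  /-- input state -/
  ψ : Matrix (Fin d × (Fin n → A)) (Fin d × (Fin n → A)) ℂ
  isDensity : IsDensity ψ
  /-- quantum test -/
  test : Matrix (Fin d × (Fin n → B)) (Fin d × (Fin n → B)) ℂ
  test_nonneg : test.PosSemidef
  test_le_one : (1 - test).PosSemidef

section Discrimination

variable {A : Type u} {B : Type v} [Fintype A] [DecidableEq A] [Fintype B] [DecidableEq B]

/-- Type I error, for the null hypothesis `N`. -/
def CoherentStrategy.typeI {n : ℕ} (S : CoherentStrategy A B n)
    (N : Matrix A A ℂ →ₗ[ℂ] Matrix B B ℂ) : ℝ :=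
  ((1 - S.test) * idTensor (Fin S.d) (tensorPow N n) S.ψ).trace.re

/-- Type II error, for the alternative hypothesis `M`. -/
def CoherentStrategy.typeII {n : ℕ} (S : CoherentStrategy A B n)
    (M : Matrix A A ℂ →ₗ[ℂ] Matrix B B ℂ) : ℝ :=
  (S.test * idTensor (Fin S.d) (tensorPow M n) S.ψ).trace.re

/-- The assertion of the exponentially strong converse conjecture for the pair `N`, `M`: for every
sequence of coherent strategies whose Type II error exponent exceeds the regularized relative
entropy, the Type I error converges to one exponentially fast. -/
def ExpStrongConverse (N M : Matrix A A ℂ →ₗ[ℂ] Matrix B B ℂ) : Prop :=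
  ∀ S : (n : ℕ) → CoherentStrategy A B n,
    regDiv umegaki N M <
        liminf (fun n : ℕ => (((1 / n : ℝ)) : EReal) * (-elog2 ((S n).typeII M))) atTop →
      ∃ c : ℝ, 0 < c ∧ ∀ᶠ n : ℕ in atTop, 1 - (S n).typeI N ≤ (2 : ℝ) ^ (-(c * n))

end Discrimination

end ChannelAEP

end

/-! Write ρ, σ for the outputs of the two n-fold channels on a common input. All four divergences
are governed by g(γ) = tr(ρ − 2^γ σ)₊, or by tests that separate ρ from σ at the threshold γ. It
suffices to show at γ = rn that g is close to 1 for some input when r < D^reg, and that g and the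
success probabilities of tests with Type II error at most 2^(−rn) are uniformly small over all
inputs when r > D^reg.

Below D^reg, some block of m uses has an input whose relative entropy exceeds r'm, with r' > r. When
the supports are nested, the relative entropy is minus the derivative at s = 0 of log tr ρ^(1−s)
σ^s, so some s ∈ (0,1) makes this quasi-entropy smaller than 2^(−s r' m) (`exists_petz_lt`); without
nested supports small s works by continuity. Quasi-entropies multiply over product inputs, so
repeating the block beats the factor 2^(s r n), and the trace inequality `re_trace_sub_le_posPart`
gives g → 1 (`eventually_exists_posPart_ge`).

Above D^reg, the strong converse is applied to one sequence of strategies that is bad whenever a bad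
strategy exists, which makes it uniform (`eventually_test_le`). The projector onto the positive part
is itself a test to which this bound applies (`eventually_posPart_le`).

The spectral divergences follow by monotonicity in γ and by optimality of projectors. For the smooth
max-divergence, `exists_smoothing` turns small g into a nearby state dominated by 2^γ σ, and the
fidelity estimate `traceNorm_sqrt_le` excludes such a state at much smaller multiples when g is
close to 1. The losses are constants in n. -/

noncomputable section

namespace ChannelAEP

open Matrix
open scoped MatrixOrder Kronecker

set_option linter.unusedSectionVars false

/-! ### Functional calculus, Loewner order and supports of matrices. -/

section FunctionalCalculus

variable {X : Type*} [Fintype X] [DecidableEq X]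

/-- The spectrum is finite, so discontinuous functions such as indicators and inverses are
admissible in the functional calculus. -/
lemma continuousOn_spectrum (f : ℝ → ℝ) (A : Matrix X X ℂ) : ContinuousOn f (spectrum ℝ A) :=
  A.finite_real_spectrum.continuousOn f

lemma cfc_mul_cfc (f g : ℝ → ℝ) (A : Matrix X X ℂ) :
    cfc f A * cfc g A = cfc (fun x => f x * g x) A :=
  (cfc_mul f g A (continuousOn_spectrum _ _) (continuousOn_spectrum _ _)).symm

lemma cfc_sub_cfc (f g : ℝ → ℝ) (A : Matrix X X ℂ) :
    cfc f A - cfc g A = cfc (fun x => f x - g x) A :=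
  (cfc_sub f g A (continuousOn_spectrum _ _) (continuousOn_spectrum _ _)).symm

lemma cfc_conjTranspose (f : ℝ → ℝ) (A : Matrix X X ℂ) : (cfc f A)ᴴ = cfc f A :=
  cfc_predicate f A

lemma cfc_le_cfc {f g : ℝ → ℝ} {A : Matrix X X ℂ} (h : ∀ x ∈ spectrum ℝ A, f x ≤ g x) :
    cfc f A ≤ cfc g A :=
  cfc_mono h (continuousOn_spectrum _ _) (continuousOn_spectrum _ _)

lemma spectrum_nonneg {A : Matrix X X ℂ} (hA : 0 ≤ A) {x : ℝ} (hx : x ∈ spectrum ℝ A) : 0 ≤ x :=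
  spectrum_nonneg_of_nonneg hA hx

lemma isHermitian_of_nonneg {A : Matrix X X ℂ} (hA : 0 ≤ A) : Aᴴ = A :=
  (nonneg_iff_posSemidef.mp hA).1

lemma cfc_self {A : Matrix X X ℂ} (hA : Aᴴ = A) : cfc (fun x : ℝ => x) A = A :=
  cfc_id' ℝ A hA

lemma cfc_one_eq {A : Matrix X X ℂ} (hA : Aᴴ = A) : cfc (fun _ : ℝ => (1 : ℝ)) A = 1 :=
  cfc_const_one ℝ A hA

lemma conj_le_conj {A B : Matrix X X ℂ} (h : A ≤ B) (C : Matrix X X ℂ) :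
    C * A * Cᴴ ≤ C * B * Cᴴ :=
  star_right_conjugate_le_conjugate h C

lemma conj_nonneg {A : Matrix X X ℂ} (h : 0 ≤ A) (C : Matrix X X ℂ) : 0 ≤ C * A * Cᴴ :=
  star_right_conjugate_nonneg h C

lemma exists_eq_mul_conjTranspose {A : Matrix X X ℂ} (hA : 0 ≤ A) :
    ∃ C : Matrix X X ℂ, A = C * Cᴴ := by
  refine ⟨cfc Real.sqrt A, ?_⟩
  rw [cfc_conjTranspose, cfc_mul_cfc]
  nth_rw 1 [← cfc_self (isHermitian_of_nonneg hA)]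
  exact cfc_congr fun x hx => (Real.mul_self_sqrt (spectrum_nonneg hA hx)).symm

lemma sqrt_mul_sqrt {A : Matrix X X ℂ} (hA : 0 ≤ A) : cfc Real.sqrt A * cfc Real.sqrt A = A := by
  rw [cfc_mul_cfc]
  nth_rw 2 [← cfc_self (isHermitian_of_nonneg hA)]
  exact cfc_congr fun x hx => Real.mul_self_sqrt (spectrum_nonneg hA hx)

lemma mul_conjTranspose_nonneg {Y : Type*} [Fintype Y] (C : Matrix X Y ℂ) : 0 ≤ C * Cᴴ :=
  nonneg_iff_posSemidef.mpr (posSemidef_self_mul_conjTranspose C)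

lemma re_trace_nonneg {A : Matrix X X ℂ} (hA : 0 ≤ A) : 0 ≤ A.trace.re :=
  (Complex.nonneg_iff.mp (nonneg_iff_posSemidef.mp hA).trace_nonneg).1

lemma re_trace_mono {A B : Matrix X X ℂ} (h : A ≤ B) : A.trace.re ≤ B.trace.re := by
  have := re_trace_nonneg (sub_nonneg.mpr h)
  rw [trace_sub, Complex.sub_re] at this
  linarith

lemma re_trace_mul_nonneg {A B : Matrix X X ℂ} (hA : 0 ≤ A) (hB : 0 ≤ B) :
    0 ≤ (A * B).trace.re := by
  obtain ⟨C, rfl⟩ := exists_eq_mul_conjTranspose hA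
  rw [Matrix.mul_assoc, trace_mul_comm, ← conjTranspose_conjTranspose C]
  simpa [Matrix.mul_assoc] using re_trace_nonneg (conj_nonneg hB Cᴴ)

lemma re_trace_mul_mono {A B C : Matrix X X ℂ} (hA : 0 ≤ A) (h : B ≤ C) :
    (A * B).trace.re ≤ (A * C).trace.re := by
  have := re_trace_mul_nonneg hA (sub_nonneg.mpr h)
  rw [Matrix.mul_sub, trace_sub, Complex.sub_re] at this
  linarith

lemma re_trace_mul_mono_left {A B C : Matrix X X ℂ} (hA : 0 ≤ A) (h : B ≤ C) :
    (B * A).trace.re ≤ (C * A).trace.re := by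
  rw [trace_mul_comm B, trace_mul_comm C]
  exact re_trace_mul_mono hA h

lemma cfc_nonneg' {f : ℝ → ℝ} {A : Matrix X X ℂ} (h : ∀ x ∈ spectrum ℝ A, 0 ≤ f x) :
    0 ≤ cfc f A :=
  cfc_nonneg h

lemma cfc_le_one' {f : ℝ → ℝ} {A : Matrix X X ℂ} (h : ∀ x ∈ spectrum ℝ A, f x ≤ 1) :
    cfc f A ≤ 1 :=
  cfc_le_one f A h

/-- Operator monotonicity of `x ↦ x ^ s` for `s ∈ [0, 1]`. -/
lemma cfc_rpow_mono {A B : Matrix X X ℂ} (hA : 0 ≤ A) (h : A ≤ B) {s : ℝ} (hs0 : 0 ≤ s)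
    (hs1 : s ≤ 1) : cfc (fun x : ℝ => x ^ s) A ≤ cfc (fun x : ℝ => x ^ s) B := by
  open scoped Matrix.Norms.L2Operator in
  have := CFC.rpow_le_rpow (p := s) ⟨hs0, hs1⟩ h
  rwa [CFC.rpow_eq_cfc_real hA, CFC.rpow_eq_cfc_real (hA.trans h)] at this

lemma cfc_sqrt_mono {A B : Matrix X X ℂ} (hA : 0 ≤ A) (h : A ≤ B) :
    cfc Real.sqrt A ≤ cfc Real.sqrt B := by
  have := cfc_rpow_mono hA h (s := 1 / 2) (by norm_num) (by norm_num)
  rwa [show (fun x : ℝ => x ^ (1 / 2 : ℝ)) = Real.sqrt from funext fun x =>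
    (Real.sqrt_eq_rpow x).symm] at this

lemma cfc_rpow_mul_rpow {A : Matrix X X ℂ} (hA : 0 ≤ A) (s : ℝ) :
    cfc (fun x : ℝ => x ^ s) A * cfc (fun x : ℝ => x ^ (1 - s)) A = A := by
  rw [cfc_mul_cfc]
  nth_rw 2 [← cfc_self (isHermitian_of_nonneg hA)]
  refine cfc_congr fun x hx => ?_
  have hx := spectrum_nonneg hA hx
  rw [← Real.rpow_add' hx (by simp)]
  simp

lemma cfc_rpow_nonneg {A : Matrix X X ℂ} (hA : 0 ≤ A) (s : ℝ) :
    0 ≤ cfc (fun x : ℝ => x ^ s) A :=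
  cfc_nonneg' fun _ hx => Real.rpow_nonneg (spectrum_nonneg hA hx) s

lemma posPart_nonneg (Y : Matrix X X ℂ) : 0 ≤ posPart Y :=
  cfc_nonneg' fun _ _ => le_max_right _ _

lemma le_posPart {Y : Matrix X X ℂ} (hY : Yᴴ = Y) : Y ≤ posPart Y := by
  nth_rw 1 [← cfc_self hY]
  exact cfc_le_cfc fun x _ => le_max_left _ _

/-- Variational upper bound: no test distinguishes better than the positive part. -/
lemma re_trace_test_le_posPart {T Y : Matrix X X ℂ} (hT0 : 0 ≤ T) (hT1 : T ≤ 1) (hY : Yᴴ = Y) :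
    (T * Y).trace.re ≤ (posPart Y).trace.re :=
  (re_trace_mul_mono hT0 (le_posPart hY)).trans <| by
    simpa using re_trace_mul_mono_left (posPart_nonneg Y) hT1

/-- The projector onto the eigenspaces of positive eigenvalues. -/
def posProj (Y : Matrix X X ℂ) : Matrix X X ℂ :=
  cfc (fun x : ℝ => if 0 < x then (1 : ℝ) else 0) Y

lemma posProj_nonneg (Y : Matrix X X ℂ) : 0 ≤ posProj Y :=
  cfc_nonneg' fun x _ => by split_ifs <;> norm_num

lemma posProj_le_one (Y : Matrix X X ℂ) : posProj Y ≤ 1 :=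
  cfc_le_one' fun x _ => by split_ifs <;> norm_num

lemma posProj_mul_self {Y : Matrix X X ℂ} (hY : Yᴴ = Y) : posProj Y * Y = posPart Y := by
  nth_rw 2 [← cfc_self hY]
  rw [posProj, cfc_mul_cfc, posPart]
  refine cfc_congr fun x _ => ?_
  split_ifs with h
  · rw [one_mul, max_eq_left h.le]
  · rw [zero_mul, max_eq_right (not_lt.mp h)]

/-- The projector onto the kernel of a Hermitian operator. -/
def kerProj (Y : Matrix X X ℂ) : Matrix X X ℂ :=
  cfc (fun x : ℝ => if x = 0 then (1 : ℝ) else 0) Y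

lemma kerProj_conjTranspose (Y : Matrix X X ℂ) : (kerProj Y)ᴴ = kerProj Y :=
  cfc_conjTranspose _ _

lemma kerProj_nonneg (Y : Matrix X X ℂ) : 0 ≤ kerProj Y :=
  cfc_nonneg' fun x _ => by split_ifs <;> norm_num

lemma kerProj_mul_kerProj (Y : Matrix X X ℂ) : kerProj Y * kerProj Y = kerProj Y := by
  rw [kerProj, cfc_mul_cfc]
  exact cfc_congr fun x _ => by simp

lemma kerProj_mul_self {Y : Matrix X X ℂ} (hY : Yᴴ = Y) : kerProj Y * Y = 0 := by
  nth_rw 2 [← cfc_self hY]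
  rw [kerProj, cfc_mul_cfc]
  convert cfc_zero (R := ℝ) Y using 2
  ext x
  simp

lemma cfc_inv_mul_self {Y : Matrix X X ℂ} (hY : Yᴴ = Y) :
    Y * cfc (fun x : ℝ => x⁻¹) Y = 1 - kerProj Y := by
  rw [← cfc_one_eq hY, kerProj, cfc_sub_cfc]
  nth_rw 1 [← cfc_self hY]
  rw [cfc_mul_cfc]
  refine cfc_congr fun x _ => ?_
  split_ifs with h
  · simp [h]
  · simp [h]

/-- The pseudo-inverse of `Y` exhibits `1 - kerProj Y` as a multiple of `Y`, so support inclusion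
becomes an algebraic identity. -/
lemma supp_le_supp_iff {A Y : Matrix X X ℂ} (hY : Yᴴ = Y) :
    supp A ≤ supp Y ↔ kerProj Y * A = 0 := by
  constructor
  · intro h
    refine Matrix.ext_of_mulVec_single fun i => ?_
    obtain ⟨z, hz⟩ : A *ᵥ Pi.single i 1 ∈ supp Y := h ⟨_, rfl⟩
    rw [mulVecLin_apply] at hz
    rw [← mulVec_mulVec, ← hz, mulVec_mulVec, kerProj_mul_self hY, zero_mulVec, zero_mulVec]
  · rintro h _ ⟨x, rfl⟩
    refine ⟨cfc (fun x : ℝ => x⁻¹) Y *ᵥ (A *ᵥ x), ?_⟩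
    rw [mulVecLin_apply, mulVec_mulVec, cfc_inv_mul_self hY, mulVec_mulVec, Matrix.sub_mul, h]
    simp

/-- With A = C C†, the trace is the squared Hilbert–Schmidt norm of `P * C`. -/
lemma mul_eq_zero_of_conj_eq_zero {A : Matrix X X ℂ} (hA : 0 ≤ A) {P : Matrix X X ℂ}
    (h : (P * A * Pᴴ).trace.re = 0) : P * A = 0 := by
  obtain ⟨C, rfl⟩ := exists_eq_mul_conjTranspose hA
  have h2 : P * (C * Cᴴ) * Pᴴ = (P * C) * (P * C)ᴴ := by
    simp [Matrix.mul_assoc]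
  rw [h2] at h
  have h3 : ((P * C) * (P * C)ᴴ).trace = 0 := by
    have := Complex.nonneg_iff.mp
      (nonneg_iff_posSemidef.mp (mul_conjTranspose_nonneg (P * C))).trace_nonneg
    exact Complex.ext h this.2.symm
  rw [trace_mul_conjTranspose_self_eq_zero_iff] at h3
  rw [← Matrix.mul_assoc, h3, Matrix.zero_mul]

lemma kerProj_mul_eq_zero_of_le {A Y : Matrix X X ℂ} (hA : 0 ≤ A) (h : A ≤ Y) :
    kerProj Y * A = 0 := by
  have hY := isHermitian_of_nonneg (hA.trans h)
  refine mul_eq_zero_of_conj_eq_zero hA (le_antisymm ?_ (re_trace_nonneg (conj_nonneg hA _)))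
  have := re_trace_mono (conj_le_conj h (kerProj Y))
  rwa [kerProj_mul_self hY, Matrix.zero_mul, trace_zero, Complex.zero_re] at this

lemma kerProj_mul_eq_zero_of_trace {A Y : Matrix X X ℂ} (hA : 0 ≤ A)
    (h : (A * kerProj Y).trace.re = 0) : kerProj Y * A = 0 := by
  refine mul_eq_zero_of_conj_eq_zero hA ?_
  rwa [kerProj_conjTranspose, trace_mul_comm, ← Matrix.mul_assoc, kerProj_mul_kerProj,
    trace_mul_comm]

/-- A positive operator supported on the support of another one is dominated by a multiple of it. -/
lemma exists_smul_ge {A Y : Matrix X X ℂ} (hA : 0 ≤ A) (hY : 0 ≤ Y) (h : kerProj Y * A = 0) :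
    ∃ t : ℝ, A ≤ t • Y := by
  have hY' := isHermitian_of_nonneg hY
  have hA' := isHermitian_of_nonneg hA
  obtain ⟨a, ha⟩ := A.finite_real_spectrum.bddAbove
  -- `b` bounds the reciprocals of the nonzero eigenvalues; a zero eigenvalue contributes 0⁻¹ = 0.
  -- With `P` the support projector, A ≤ max(a,0) P and P ≤ b Y.
  obtain ⟨b, hb⟩ := (Y.finite_real_spectrum.image (fun x => x⁻¹)).bddAbove
  set P := 1 - kerProj Y with hP
  have hPH : Pᴴ = P := by simp [hP, kerProj_conjTranspose]
  have hPA : P * A = A := by simp [hP, Matrix.sub_mul, h]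
  have hAP : A * P = A := by
    have := congrArg conjTranspose hPA
    rwa [conjTranspose_mul, hA', hPH] at this
  have hPP : P * P = P := by
    simp [hP, Matrix.sub_mul, Matrix.mul_sub, kerProj_mul_kerProj]
  have h1 : A ≤ (max a 0) • (1 : Matrix X X ℂ) := by
    nth_rw 1 [← cfc_self hA']
    rw [← cfc_one_eq hA', ← cfc_smul _ _ _ (continuousOn_spectrum _ _)]
    exact cfc_le_cfc fun x hx => by simpa using Or.inl (ha hx)
  have h2 : A ≤ (max a 0) • P := by
    have := conj_le_conj h1 P
    rwa [hPH, hPA, hAP, Matrix.mul_smul, Matrix.smul_mul, Matrix.mul_one, hPP] at this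
  refine ⟨max a 0 * b, h2.trans ?_⟩
  rw [mul_smul]
  refine smul_le_smul_of_nonneg_left ?_ (le_max_right _ _)
  rw [hP, ← cfc_one_eq hY', kerProj, cfc_sub_cfc]
  nth_rw 2 [← cfc_self hY']
  rw [← cfc_smul _ _ _ (continuousOn_spectrum _ _)]
  refine cfc_le_cfc fun x hx => ?_
  have hx0 := spectrum_nonneg hY hx
  simp only [smul_eq_mul]
  split_ifs with h0
  · simp [h0]
  · have := hb ⟨x, hx, rfl⟩
    have hx1 : 0 < x := lt_of_le_of_ne hx0 (Ne.symm h0)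
    have h3 := mul_le_mul_of_nonneg_right this hx0
    rw [inv_mul_cancel₀ h0] at h3
    linarith

end FunctionalCalculus

/-! ### Trace inequalities, fidelity and smoothing. -/

section TraceInequalities

variable {X : Type*} [Fintype X] [DecidableEq X]

/-- The trace inequality of Audenaert et al. -/
lemma re_trace_sub_le_posPart {A B : Matrix X X ℂ} (hA : 0 ≤ A) (hB : 0 ≤ B) {s : ℝ}
    (hs0 : 0 < s) (hs1 : s < 1) :
    A.trace.re - (cfc (fun x : ℝ => x ^ (1 - s)) A * cfc (fun x : ℝ => x ^ s) B).trace.re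
      ≤ (posPart (A - B)).trace.re := by
  have hH : (A - B)ᴴ = A - B := by
    rw [conjTranspose_sub, isHermitian_of_nonneg hA, isHermitian_of_nonneg hB]
  -- `C` dominates both `A` and `B`, and tr C − tr B is the right-hand side. Operator monotonicity
  -- gives tr A ≤ tr C^s A^(1−s), and then tr (C^s − B^s) A^(1−s) ≤ tr (C^s − B^s) C^(1−s) ≤ tr C −
  -- tr B.
  set C := B + posPart (A - B) with hC
  have hBC : B ≤ C := le_add_of_nonneg_right (posPart_nonneg _)
  have hAC : A ≤ C := by simpa [hC] using add_le_add_right (le_posPart hH) B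
  have hC0 : 0 ≤ C := hB.trans hBC
  have h1 := re_trace_mul_mono_left (cfc_rpow_nonneg hA (1 - s))
    (cfc_rpow_mono hA hAC hs0.le hs1.le)
  have h2 := re_trace_mul_mono (sub_nonneg.mpr (cfc_rpow_mono hB hBC hs0.le hs1.le))
    (cfc_rpow_mono hA hAC (sub_nonneg.mpr hs1.le) (sub_le_self 1 hs0.le))
  have h3 := re_trace_mul_mono (cfc_rpow_nonneg hB s)
    (cfc_rpow_mono hB hBC (sub_nonneg.mpr hs1.le) (sub_le_self 1 hs0.le))
  rw [cfc_rpow_mul_rpow hA s] at h1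
  rw [cfc_rpow_mul_rpow hB s] at h3
  simp only [Matrix.sub_mul, trace_sub, Complex.sub_re, cfc_rpow_mul_rpow hC0 s] at h2
  have h4 : C.trace.re = B.trace.re + (posPart (A - B)).trace.re := by
    rw [hC, trace_add, Complex.add_re]
  rw [trace_mul_comm (cfc (fun x : ℝ => x ^ (1 - s)) A)]
  linarith

/-- Cauchy–Schwarz for the Hilbert–Schmidt product, from the discriminant of c ↦ ‖A − c B†‖². -/
lemma re_trace_mul_le_sqrt (A B : Matrix X X ℂ) :
    (A * B).trace.re ≤ √((A * Aᴴ).trace.re) * √((Bᴴ * B).trace.re) := by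
  have hAA := re_trace_nonneg (mul_conjTranspose_nonneg A)
  rw [← Real.sqrt_mul hAA]
  apply Real.le_sqrt_of_sq_le
  have key : ∀ c : ℝ, 0 ≤ (Bᴴ * B).trace.re * (c * c) + (-2 * (A * B).trace.re) * c
      + (A * Aᴴ).trace.re := by
    intro c
    have h := re_trace_nonneg (mul_conjTranspose_nonneg (A - (c : ℂ) • Bᴴ))
    have h1 : ((A - (c : ℂ) • Bᴴ) * (A - (c : ℂ) • Bᴴ)ᴴ).trace
        = (A * Aᴴ).trace - c * (A * B).trace - c * star (A * B).trace
          + c * c * (Bᴴ * B).trace := by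
      rw [← trace_conjTranspose, conjTranspose_mul]
      simp [Matrix.sub_mul, Matrix.mul_sub, trace_sub, trace_smul]
      ring
    rw [h1] at h
    simp at h
    linarith
  have := discrim_le_zero key
  rw [discrim] at this
  linarith

/-- Polar decomposition with a contraction in place of the unitary. -/
lemma exists_polar (C : Matrix X X ℂ) :
    ∃ V : Matrix X X ℂ, V * Vᴴ ≤ 1 ∧ cfc Real.sqrt (C * Cᴴ) * V = C ∧
      V * Cᴴ = cfc Real.sqrt (C * Cᴴ) := by
  have h0 := mul_conjTranspose_nonneg C
  have hH := isHermitian_of_nonneg h0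
  have hker : kerProj (C * Cᴴ) * C = 0 := by
    rw [← trace_mul_conjTranspose_self_eq_zero_iff, conjTranspose_mul, Matrix.mul_assoc,
      ← Matrix.mul_assoc C, ← Matrix.mul_assoc, kerProj_mul_self hH, Matrix.zero_mul, trace_zero]
  -- V = (C C†)^(−1/2) C, the inverse being 0 on the kernel: a partial isometry, so no unitary
  -- completion is needed.
  refine ⟨cfc (fun x : ℝ => (√x)⁻¹) (C * Cᴴ) * C, ?_, ?_, ?_⟩
  · rw [conjTranspose_mul, cfc_conjTranspose, Matrix.mul_assoc, ← Matrix.mul_assoc C]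
    nth_rw 2 [← cfc_self hH]
    rw [cfc_mul_cfc, cfc_mul_cfc]
    refine cfc_le_one' fun x hx => ?_
    have hx0 := spectrum_nonneg h0 hx
    rcases hx0.eq_or_lt with rfl | h
    · simp
    · have h1 := Real.sqrt_pos.mpr h
      nth_rw 2 [← Real.mul_self_sqrt hx0]
      field_simp
      rfl
  · rw [← Matrix.mul_assoc, cfc_mul_cfc]
    have : cfc (fun x : ℝ => √x * (√x)⁻¹) (C * Cᴴ) = 1 - kerProj (C * Cᴴ) := by
      rw [← cfc_one_eq hH, kerProj, cfc_sub_cfc]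
      refine cfc_congr fun x hx => ?_
      have hx0 := spectrum_nonneg h0 hx
      rcases hx0.eq_or_lt with rfl | h
      · simp
      · have h1 := (Real.sqrt_pos.mpr h).ne'
        simp [h.ne', h1]
    rw [this, Matrix.sub_mul, hker, Matrix.one_mul, sub_zero]
  · rw [Matrix.mul_assoc]
    nth_rw 2 [← cfc_self hH]
    rw [cfc_mul_cfc]
    refine cfc_congr fun x hx => ?_
    have hx0 := spectrum_nonneg h0 hx
    rcases hx0.eq_or_lt with rfl | h
    · simp
    · have h1 := (Real.sqrt_pos.mpr h).ne'
      nth_rw 2 [← Real.mul_self_sqrt hx0]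
      field_simp

lemma conj_contraction_le {V : Matrix X X ℂ} (hV : V * Vᴴ ≤ 1) (S : Matrix X X ℂ) :
    (S * V) * (S * V)ᴴ ≤ S * Sᴴ := by
  have := conj_le_conj hV S
  simpa [Matrix.mul_assoc] using this

lemma contraction_mul {V W : Matrix X X ℂ} (hV : V * Vᴴ ≤ 1) (hW : W * Wᴴ ≤ 1) :
    (V * W) * (V * W)ᴴ ≤ 1 :=
  (conj_contraction_le hW V).trans hV

lemma cfc_sqrt_conjTranspose_mul_nonneg (Z : Matrix X X ℂ) : 0 ≤ cfc Real.sqrt (Zᴴ * Z) :=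
  cfc_nonneg' fun _ _ => Real.sqrt_nonneg _

/-- With Z = U†P and P = S², Cauchy–Schwarz puts one `S` in each factor; contractions leave each
squared norm at most tr P. -/
lemma re_trace_le_traceNorm {V W : Matrix X X ℂ} (hV : V * Vᴴ ≤ 1) (hW : W * Wᴴ ≤ 1)
    (Z : Matrix X X ℂ) : (Vᴴ * Z * W).trace.re ≤ traceNorm Z := by
  obtain ⟨U, hU, hU1, -⟩ := exists_polar Zᴴ
  rw [conjTranspose_conjTranspose] at hU1
  set P := cfc Real.sqrt (Zᴴ * Z) with hP
  have hP0 : 0 ≤ P := cfc_sqrt_conjTranspose_mul_nonneg Z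
  obtain ⟨S, hS, hSH⟩ : ∃ S : Matrix X X ℂ, S * S = P ∧ Sᴴ = S :=
    ⟨_, sqrt_mul_sqrt hP0, cfc_conjTranspose _ _⟩
  have hZ : Z = Uᴴ * P := by
    have := congrArg conjTranspose hU1
    rw [conjTranspose_conjTranspose, conjTranspose_mul, isHermitian_of_nonneg hP0] at this
    exact this.symm
  have h1 : (Vᴴ * Z * W).trace = ((S * W) * (S * (U * V))ᴴ).trace := by
    rw [hZ, ← hS]
    simp only [conjTranspose_mul, hSH, Matrix.mul_assoc]
    rw [trace_mul_comm S, ← Matrix.mul_assoc Vᴴ, trace_mul_comm (Vᴴ * Uᴴ)]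
    simp only [Matrix.mul_assoc]
    rw [← Matrix.mul_assoc S S, trace_mul_comm (S * S)]
    simp only [Matrix.mul_assoc]
  rw [h1]
  refine (re_trace_mul_le_sqrt _ _).trans ?_
  rw [conjTranspose_conjTranspose]
  have h2 := re_trace_mono (conj_contraction_le hW S)
  have h3 := re_trace_mono (conj_contraction_le (contraction_mul hU hV) S)
  rw [hSH, hS] at h2 h3
  have h4 : 0 ≤ P.trace.re := re_trace_nonneg hP0
  calc _ ≤ √P.trace.re * √P.trace.re := by gcongr
    _ = traceNorm Z := Real.mul_self_sqrt h4

/-- The easy half of Uhlmann's theorem. -/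
lemma re_trace_le_traceNorm_sqrt (A B : Matrix X X ℂ) :
    (Aᴴ * B).trace.re ≤ traceNorm (cfc Real.sqrt (A * Aᴴ) * cfc Real.sqrt (B * Bᴴ)) := by
  obtain ⟨V, hV, hV1, -⟩ := exists_polar A
  obtain ⟨W, hW, hW1, -⟩ := exists_polar B
  convert re_trace_le_traceNorm hV hW _ using 3
  nth_rw 1 [← hV1, ← hW1]
  simp only [conjTranspose_mul, cfc_conjTranspose, Matrix.mul_assoc]

/-- Insert 1 = T + (1 − T) between the square roots and apply Cauchy–Schwarz to each term. The bound
is small when the projector `T` captures most of `B` but little of `A`. -/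
lemma traceNorm_sqrt_le {A B T : Matrix X X ℂ} (hA : 0 ≤ A) (hB : 0 ≤ B) (hT0 : 0 ≤ T)
    (hT : T * T = T) :
    traceNorm (cfc Real.sqrt A * cfc Real.sqrt B)
      ≤ √(B.trace.re) * √((T * A).trace.re) + √(((1 - T) * B).trace.re) * √(A.trace.re) := by
  set a := cfc Real.sqrt A with ha
  set b := cfc Real.sqrt B with hb
  have haH : aᴴ = a := cfc_conjTranspose _ _
  have hbH : bᴴ = b := cfc_conjTranspose _ _
  have haa : a * a = A := sqrt_mul_sqrt hA
  have hbb : b * b = B := sqrt_mul_sqrt hB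
  have hTH := isHermitian_of_nonneg hT0
  obtain ⟨V, hV, -, hV2⟩ := exists_polar (a * b)ᴴ
  rw [conjTranspose_conjTranspose] at hV2
  have h0 : traceNorm (a * b) = (V * (a * b)).trace.re := by
    rw [hV2]; rfl
  have h1 : (V * (a * b)).trace = ((b * V) * (a * T)).trace
      + (((1 - T) * b * V) * a).trace := by
    have e1 : ((b * V) * (a * T)).trace = (V * a * T * b).trace := by
      rw [trace_mul_comm, ← Matrix.mul_assoc, trace_mul_comm]
      simp only [Matrix.mul_assoc]
    have e2 : (((1 - T) * b * V) * a).trace = (V * a * (1 - T) * b).trace := by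
      rw [Matrix.mul_assoc, trace_mul_comm]
      simp only [Matrix.mul_assoc]
    rw [e1, e2, ← trace_add]
    simp [Matrix.mul_sub, Matrix.sub_mul, Matrix.mul_assoc]
  rw [h0, h1, Complex.add_re]
  have g1 := re_trace_mul_le_sqrt (b * V) (a * T)
  have g2 := re_trace_mul_le_sqrt ((1 - T) * b * V) a
  have k1 := re_trace_mono (conj_contraction_le hV b)
  have k2 := re_trace_mono (conj_contraction_le hV ((1 - T) * b))
  have k3 : ((a * T)ᴴ * (a * T)).trace = (T * A).trace := by
    rw [conjTranspose_mul, haH, hTH, ← Matrix.mul_assoc, trace_mul_comm, Matrix.mul_assoc T, haa,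
      ← Matrix.mul_assoc, hT]
  have k4 : ((1 - T) * b * ((1 - T) * b)ᴴ).trace = ((1 - T) * B).trace := by
    have : (1 - T) * (1 - T) = 1 - T := by simp [Matrix.mul_sub, Matrix.sub_mul, hT]
    rw [conjTranspose_mul, conjTranspose_sub, conjTranspose_one, hTH, hbH, Matrix.mul_assoc,
      ← Matrix.mul_assoc b, hbb, trace_mul_comm, Matrix.mul_assoc, this, trace_mul_comm]
  rw [hbH, hbb] at k1
  rw [k4] at k2
  rw [k3] at g1
  rw [haH, haa] at g2
  exact add_le_add (g1.trans (by gcongr)) (g2.trans (by gcongr))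

/-- T = C^(−1/2) A C^(−1/2) with the inverse on the support of `C`; nothing of `A` is lost because A
≤ C places its support there. -/
lemma exists_sqrt_conj {A C : Matrix X X ℂ} (hA : 0 ≤ A) (h : A ≤ C) :
    ∃ T : Matrix X X ℂ, 0 ≤ T ∧ T ≤ 1 ∧ cfc Real.sqrt C * T * cfc Real.sqrt C = A := by
  have hC0 := hA.trans h
  have hCH := isHermitian_of_nonneg hC0
  have hAH := isHermitian_of_nonneg hA
  set W := cfc (fun x : ℝ => (√x)⁻¹) C with hW
  have hWH : Wᴴ = W := cfc_conjTranspose _ _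
  have hsW : cfc Real.sqrt C * W = 1 - kerProj C := by
    rw [hW, cfc_mul_cfc, ← cfc_one_eq hCH, kerProj, cfc_sub_cfc]
    refine cfc_congr fun x hx => ?_
    have hx0 := spectrum_nonneg hC0 hx
    rcases hx0.eq_or_lt with rfl | h
    · simp
    · have h1 := (Real.sqrt_pos.mpr h).ne'
      simp [h.ne', h1]
  have hWs : W * cfc Real.sqrt C = 1 - kerProj C := by
    rw [← hsW, hW, cfc_mul_cfc, cfc_mul_cfc]
    exact cfc_congr fun x _ => mul_comm _ _
  have hk := kerProj_mul_eq_zero_of_le hA h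
  have hk' : A * kerProj C = 0 := by
    have := congrArg conjTranspose hk
    rwa [conjTranspose_mul, hAH, kerProj_conjTranspose, conjTranspose_zero] at this
  refine ⟨W * A * W, ?_, ?_, ?_⟩
  · simpa [hWH] using conj_nonneg hA W
  · have h1 := conj_le_conj h W
    rw [hWH] at h1
    refine h1.trans ?_
    rw [← sqrt_mul_sqrt hC0, ← Matrix.mul_assoc, hWs, Matrix.mul_assoc, hsW]
    simpa [Matrix.mul_sub, Matrix.sub_mul, kerProj_mul_kerProj] using kerProj_nonneg C
  · rw [Matrix.mul_assoc, Matrix.mul_assoc (W * A), hWs, ← Matrix.mul_assoc,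
      ← Matrix.mul_assoc (cfc Real.sqrt C), hsW, Matrix.sub_mul, hk, Matrix.one_mul, sub_zero,
      Matrix.mul_sub, hk', sub_zero, Matrix.mul_one]

/-- Smoothing: a state can be replaced by a nearby subnormalized state dominated by `τ`. -/
lemma exists_smoothing {ρ τ : Matrix X X ℂ} (hρ : IsDensity ρ) (hτ : 0 ≤ τ) :
    ∃ ρ' : Matrix X X ℂ, 0 ≤ ρ' ∧ ρ' ≤ τ ∧ ρ'.trace.re ≤ 1 ∧
      purifiedDist ρ' ρ ≤ √(2 * (posPart (ρ - τ)).trace.re) := by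
  have hρ0 : 0 ≤ ρ := nonneg_iff_posSemidef.mpr hρ.1
  have hH : (ρ - τ)ᴴ = ρ - τ := by
    rw [conjTranspose_sub, isHermitian_of_nonneg hρ0, isHermitian_of_nonneg hτ]
  -- `ω` dominates `ρ`, so ρ = √ω K K† √ω with K K† ≤ 1. The smoothed state replaces √ω by √τ.
  set ω := τ + posPart (ρ - τ) with hω
  have hτω : τ ≤ ω := le_add_of_nonneg_right (posPart_nonneg _)
  have hρω : ρ ≤ ω := by simpa [hω] using add_le_add_right (le_posPart hH) τ
  have hω0 : 0 ≤ ω := hτ.trans hτω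
  obtain ⟨T, hT0, hT1, hT⟩ := exists_sqrt_conj hρ0 hρω
  obtain ⟨K, rfl⟩ := exists_eq_mul_conjTranspose hT0
  set t := cfc Real.sqrt τ with ht
  set w := cfc Real.sqrt ω with hw
  have htH : tᴴ = t := cfc_conjTranspose _ _
  have hwH : wᴴ = w := cfc_conjTranspose _ _
  have htt : t * t = τ := sqrt_mul_sqrt hτ
  have hww : w * w = ω := sqrt_mul_sqrt hω0
  have eρ : (w * K) * (w * K)ᴴ = ρ := by
    rw [← hT, conjTranspose_mul, hwH]
    simp only [Matrix.mul_assoc]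
  have htr : (K * Kᴴ * ω).trace.re = 1 := by
    rw [← hww, ← Matrix.mul_assoc, trace_mul_comm, ← Matrix.mul_assoc, hT, hρ.2, Complex.one_re]
  have eρ' : ((t * K) * (t * K)ᴴ).trace = (K * Kᴴ * τ).trace := by
    rw [conjTranspose_mul, htH, ← htt, ← Matrix.mul_assoc (K * Kᴴ), trace_mul_comm (K * Kᴴ * t)]
    simp only [Matrix.mul_assoc]
  have hF : (K * Kᴴ * (t * w)).trace.re
      ≤ traceNorm (cfc Real.sqrt ((t * K) * (t * K)ᴴ) * cfc Real.sqrt ρ) := by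
    have := re_trace_le_traceNorm_sqrt (t * K) (w * K)
    rw [eρ] at this
    convert this using 2
    rw [conjTranspose_mul, htH, Matrix.mul_assoc, trace_mul_comm]
    simp only [Matrix.mul_assoc]
  have hsw : (K * Kᴴ * (t * w)).trace.re = (K * Kᴴ * (w * t)).trace.re := by
    rw [← Complex.conj_re (K * Kᴴ * (w * t)).trace, starRingEnd_apply, ← trace_conjTranspose,
      conjTranspose_mul, conjTranspose_mul, htH, hwH, trace_mul_comm]
    simp
  -- Compare the trace against K K† with the full trace for the positive operator (ω − τ) + (√ω −
  -- √τ)². Adding ω − τ leaves 2ω − √τ√ω − √ω√τ, whose ω-term is known since tr K K† ω = 1; √τ ≤ √ω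
  -- bounds the full trace by 2(tr ω − tr τ).
  have hη : 1 - (K * Kᴴ * (t * w)).trace.re ≤ (posPart (ρ - τ)).trace.re := by
    have hsq : 0 ≤ (w - t) * (w - t)ᴴ := mul_conjTranspose_nonneg _
    have hpos : 0 ≤ (ω - τ) + (w - t) * (w - t)ᴴ := add_nonneg (sub_nonneg.mpr hτω) hsq
    have h1 := re_trace_mul_mono_left hpos hT1
    have e : (ω - τ) + (w - t) * (w - t)ᴴ = (2 : ℝ) • ω - t * w - w * t := by
      rw [conjTranspose_sub, htH, hwH, Matrix.sub_mul, Matrix.mul_sub, Matrix.mul_sub, hww, htt,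
        two_smul]
      abel
    rw [e] at h1
    simp only [Matrix.mul_sub, Matrix.mul_smul, Matrix.one_mul, trace_sub, trace_smul,
      Complex.sub_re, Complex.smul_re, htr, ← hsw] at h1
    have h2 : (w * t).trace.re = (t * w).trace.re := by rw [trace_mul_comm]
    have h3 := re_trace_mul_mono (cfc_nonneg' (f := Real.sqrt) (A := τ) fun _ _ => Real.sqrt_nonneg _)
      (cfc_sqrt_mono hτ hτω)
    rw [← ht, ← hw, htt] at h3
    have h4 : ω.trace.re = τ.trace.re + (posPart (ρ - τ)).trace.re := by
      rw [hω, trace_add, Complex.add_re]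
    simp only [smul_eq_mul] at h1
    linarith
  refine ⟨(t * K) * (t * K)ᴴ, mul_conjTranspose_nonneg _, ?_, ?_, ?_⟩
  · have := conj_contraction_le hT1 t
    rwa [htH, htt] at this
  · rw [eρ', ← htr]
    exact re_trace_mul_mono hT0 hτω
  · refine Real.sqrt_le_sqrt ?_
    have hη0 : 0 ≤ (posPart (ρ - τ)).trace.re := re_trace_nonneg (posPart_nonneg _)
    have hF2 : fidelity ((t * K) * (t * K)ᴴ) ρ
        = traceNorm (cfc Real.sqrt ((t * K) * (t * K)ᴴ) * cfc Real.sqrt ρ) := by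
      simp [fidelity, hρ.2]
    rw [hF2]
    -- 1 − F² ≤ 2(1 − F).
    nlinarith [hF, hη]

end TraceInequalities

/-! ### Diagonalization and Petz quasi-entropies. -/

section Spectral

variable {X : Type*} [Fintype X] [DecidableEq X]

lemma exists_spectral {A : Matrix X X ℂ} (hA : Aᴴ = A) :
    ∃ (U : Matrix X X ℂ) (d : X → ℝ), Uᴴ * U = 1 ∧ (∀ i, d i ∈ spectrum ℝ A) ∧
      ∀ f : ℝ → ℝ, cfc f A = U * diagonal (fun i => (f (d i) : ℂ)) * Uᴴ := by
  have hA' : A.IsHermitian := hA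
  refine ⟨hA'.eigenvectorUnitary, hA'.eigenvalues, ?_, hA'.eigenvalues_mem_spectrum_real, ?_⟩
  · exact Unitary.coe_star_mul_self _
  · intro f
    rw [hA'.cfc_eq]
    rfl

/-- The functional calculus can be computed in any diagonalization. -/
lemma cfc_eq_of_diagonal {U : Matrix X X ℂ} (hU : Uᴴ * U = 1) (d : X → ℝ) (f : ℝ → ℝ) :
    cfc f (U * diagonal (fun i => (d i : ℂ)) * Uᴴ)
      = U * diagonal (fun i => (f (d i) : ℂ)) * Uᴴ := by
  set A := U * diagonal (fun i => (d i : ℂ)) * Uᴴ with hA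
  have hAH : Aᴴ = A := by
    rw [hA, conjTranspose_mul, conjTranspose_mul, conjTranspose_conjTranspose,
      diagonal_conjTranspose, Matrix.mul_assoc]
    congr 3
    ext i
    simp
  obtain ⟨V, e, hV, -, h⟩ := exists_spectral hAH
  have hVV : V * Vᴴ = 1 := mul_eq_one_comm.mp hV
  have hUU : U * Uᴴ = 1 := mul_eq_one_comm.mp hU
  have h1 : V * diagonal (fun i => (e i : ℂ)) * Vᴴ = A := by
    rw [← h (fun x => x), cfc_self hAH]
  -- The change of basis intertwines the two diagonals, so its entries vanish unless the eigenvalues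
  -- agree; hence it also intertwines their images under `f`.
  have h2 : diagonal (fun i => (e i : ℂ)) * (Vᴴ * U) = (Vᴴ * U) * diagonal (fun i => (d i : ℂ)) := by
    calc diagonal (fun i => (e i : ℂ)) * (Vᴴ * U)
        = Vᴴ * (V * diagonal (fun i => (e i : ℂ)) * Vᴴ) * U := by
          simp only [← Matrix.mul_assoc, hV, Matrix.one_mul]
      _ = Vᴴ * A * U := by rw [h1]
      _ = _ := by simp only [hA, Matrix.mul_assoc, hU, Matrix.mul_one]
  have h3 : diagonal (fun i => (f (e i) : ℂ)) * (Vᴴ * U)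
      = (Vᴴ * U) * diagonal (fun i => (f (d i) : ℂ)) := by
    ext i j
    have := congrFun (congrFun h2 i) j
    rw [diagonal_mul, mul_diagonal] at this ⊢
    by_cases hz : (Vᴴ * U) i j = 0
    · simp [hz]
    · rw [mul_comm] at this
      have h4 := mul_left_cancel₀ hz this
      rw [Complex.ofReal_inj] at h4
      rw [h4, mul_comm]
  calc cfc f A = V * (diagonal (fun i => (f (e i) : ℂ)) * (Vᴴ * U)) * Uᴴ := by
        rw [h]; simp only [Matrix.mul_assoc, hUU, Matrix.mul_one]
    _ = _ := by rw [h3]; simp only [← Matrix.mul_assoc, hVV, Matrix.one_mul]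

lemma cfc_submatrix {Y : Type*} [Fintype Y] [DecidableEq Y] (e : Y ≃ X) (f : ℝ → ℝ)
    {A : Matrix X X ℂ} (hA : Aᴴ = A) : cfc f (A.submatrix e e) = (cfc f A).submatrix e e := by
  obtain ⟨U, d, hU, -, h⟩ := exists_spectral hA
  have key : ∀ g : ℝ → ℝ, (cfc g A).submatrix e e
      = U.submatrix e e * diagonal (fun i => (g (d (e i)) : ℂ)) * (U.submatrix e e)ᴴ := by
    intro g
    rw [h, conjTranspose_submatrix, ← submatrix_mul_equiv _ _ _ e, ← submatrix_mul_equiv _ _ _ e,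
      submatrix_diagonal_equiv]
    rfl
  have h1 := key (fun x => x)
  rw [cfc_self hA] at h1
  rw [h1, key f]
  refine cfc_eq_of_diagonal ?_ (fun i => d (e i)) f
  rw [conjTranspose_submatrix, submatrix_mul_equiv, hU, submatrix_one_equiv]

lemma cfc_rpow_kronecker {Y : Type*} [Fintype Y] [DecidableEq Y] {A : Matrix X X ℂ}
    {B : Matrix Y Y ℂ} (hA : 0 ≤ A) (hB : 0 ≤ B) (s : ℝ) :
    cfc (fun x : ℝ => x ^ s) (A ⊗ₖ B)
      = cfc (fun x : ℝ => x ^ s) A ⊗ₖ cfc (fun x : ℝ => x ^ s) B := by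
  obtain ⟨U, d, hU, hd, h⟩ := exists_spectral (isHermitian_of_nonneg hA)
  obtain ⟨V, e, hV, he, h'⟩ := exists_spectral (isHermitian_of_nonneg hB)
  have key : ∀ g : ℝ → ℝ, cfc g A ⊗ₖ cfc g B
      = (U ⊗ₖ V) * diagonal (fun i => ((g (d i.1) * g (e i.2) : ℝ) : ℂ)) * (U ⊗ₖ V)ᴴ := by
    intro g
    rw [h, h', mul_kronecker_mul, mul_kronecker_mul, diagonal_kronecker_diagonal,
      conjTranspose_kronecker]
    simp
  have h1 := key (fun x => x)
  rw [cfc_self (isHermitian_of_nonneg hA), cfc_self (isHermitian_of_nonneg hB)] at h1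
  rw [h1, key, cfc_eq_of_diagonal (U := U ⊗ₖ V) _ (fun i => d i.1 * e i.2)]
  · congr 3
    ext i
    rw [Real.mul_rpow (spectrum_nonneg hA (hd _)) (spectrum_nonneg hB (he _))]
  · rw [conjTranspose_kronecker, ← mul_kronecker_mul, hU, hV, one_kronecker_one]

/-- Joint spectral weights of two positive operators. -/
lemma exists_joint_spectral {A B : Matrix X X ℂ} (hA : 0 ≤ A) (hB : 0 ≤ B) :
    ∃ (p q : X → ℝ) (w : X → X → ℝ), (∀ i, 0 ≤ p i) ∧ (∀ j, 0 ≤ q j) ∧ (∀ i j, 0 ≤ w i j) ∧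
      ∀ f g : ℝ → ℝ, (cfc f A * cfc g B).trace.re = ∑ i, ∑ j, w i j * (f (p i) * g (q j)) := by
  obtain ⟨U, d, hU, hd, h⟩ := exists_spectral (isHermitian_of_nonneg hA)
  obtain ⟨V, e, hV, he, h'⟩ := exists_spectral (isHermitian_of_nonneg hB)
  refine ⟨d, e, fun i j => Complex.normSq ((Uᴴ * V) i j), fun i => spectrum_nonneg hA (hd i),
    fun i => spectrum_nonneg hB (he i), fun i j => Complex.normSq_nonneg _, fun f g => ?_⟩
  have h1 : (cfc f A * cfc g B).trace = (diagonal (fun i => (f (d i) : ℂ)) * (Uᴴ * V)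
      * (diagonal (fun i => (g (e i) : ℂ)) * (Uᴴ * V)ᴴ)).trace := by
    rw [h, h', conjTranspose_mul, conjTranspose_conjTranspose, Matrix.mul_assoc U,
      Matrix.mul_assoc U, trace_mul_comm U]
    simp only [Matrix.mul_assoc]
  rw [h1, trace, Complex.re_sum]
  refine Finset.sum_congr rfl fun i _ => ?_
  rw [diag_apply, Matrix.mul_apply, Complex.re_sum]
  refine Finset.sum_congr rfl fun j _ => ?_
  rw [diagonal_mul, diagonal_mul, conjTranspose_apply]
  have : (f (d i) : ℂ) * (Uᴴ * V) i j * ((g (e j) : ℂ) * star ((Uᴴ * V) i j))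
      = ((Complex.normSq ((Uᴴ * V) i j) * (f (d i) * g (e j)) : ℝ) : ℂ) := by
    push_cast
    rw [← Complex.mul_conj]
    simp only [Complex.star_def]
    ring
  rw [this, Complex.ofReal_re]

/-- The Petz quasi-entropy `tr ρ^(1-s) σ^s`. -/
def petz (s : ℝ) (ρ σ : Matrix X X ℂ) : ℝ :=
  (cfc (fun x : ℝ => x ^ (1 - s)) ρ * cfc (fun x : ℝ => x ^ s) σ).trace.re

lemma petz_nonneg {ρ σ : Matrix X X ℂ} (hρ : 0 ≤ ρ) (hσ : 0 ≤ σ) (s : ℝ) : 0 ≤ petz s ρ σ :=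
  re_trace_mul_nonneg (cfc_rpow_nonneg hρ _) (cfc_rpow_nonneg hσ _)

lemma petz_submatrix {Y : Type*} [Fintype Y] [DecidableEq Y] (e : Y ≃ X)
    {ρ σ : Matrix X X ℂ} (hρ : 0 ≤ ρ) (hσ : 0 ≤ σ) (s : ℝ) :
    petz s (ρ.submatrix e e) (σ.submatrix e e) = petz s ρ σ := by
  rw [petz, cfc_submatrix e _ (isHermitian_of_nonneg hρ),
    cfc_submatrix e _ (isHermitian_of_nonneg hσ), submatrix_mul_equiv, petz]
  simp only [trace, diag_apply, submatrix_apply]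
  rw [Equiv.sum_comp e (fun i => (cfc (fun x : ℝ => x ^ (1 - s)) ρ * cfc (fun x : ℝ => x ^ s) σ) i i)]

lemma petz_kronecker {Y : Type*} [Fintype Y] [DecidableEq Y] {ρ σ : Matrix X X ℂ}
    {ρ' σ' : Matrix Y Y ℂ} (hρ : 0 ≤ ρ) (hσ : 0 ≤ σ) (hρ' : 0 ≤ ρ') (hσ' : 0 ≤ σ') (s : ℝ) :
    petz s (ρ ⊗ₖ ρ') (σ ⊗ₖ σ') = petz s ρ σ * petz s ρ' σ' := by
  -- The real part of a product of traces factors because these traces are real.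
  have him : ∀ {Z : Type _} [Fintype Z] [DecidableEq Z] {a b : Matrix Z Z ℂ}, 0 ≤ a → 0 ≤ b →
      (a * b).trace.im = 0 := by
    intro Z _ _ a b ha hb
    obtain ⟨C, rfl⟩ := exists_eq_mul_conjTranspose ha
    rw [Matrix.mul_assoc, trace_mul_comm, ← conjTranspose_conjTranspose C]
    have := (nonneg_iff_posSemidef.mp (conj_nonneg hb Cᴴ)).trace_nonneg
    simpa [Matrix.mul_assoc] using (Complex.nonneg_iff.mp this).2.symm
  rw [petz, cfc_rpow_kronecker hρ hρ', cfc_rpow_kronecker hσ hσ', ← mul_kronecker_mul,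
    trace_kronecker, Complex.mul_re, him (cfc_rpow_nonneg hρ _) (cfc_rpow_nonneg hσ _)]
  simp [petz]

lemma petz_smul_right {ρ σ : Matrix X X ℂ} (hσ : 0 ≤ σ) {c : ℝ} (hc : 0 ≤ c) (s : ℝ) :
    petz s ρ (c • σ) = c ^ s * petz s ρ σ := by
  have hH := isHermitian_of_nonneg hσ
  have : cfc (fun x : ℝ => x ^ s) (c • σ) = c ^ s • cfc (fun x : ℝ => x ^ s) σ := by
    nth_rw 1 [← cfc_self hH]
    rw [← cfc_smul _ _ _ (continuousOn_spectrum _ _), ← cfc_smul _ _ _ (continuousOn_spectrum _ _),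
      ← cfc_comp' (fun x : ℝ => x ^ s) (fun x : ℝ => c • x) σ
        ((σ.finite_real_spectrum.image _).continuousOn _) (continuousOn_spectrum _ _)
        (show IsSelfAdjoint σ from hH)]
    exact cfc_congr fun x hx => Real.mul_rpow hc (spectrum_nonneg hσ hx)
  rw [petz, this, Matrix.mul_smul, trace_smul, Complex.smul_re, smul_eq_mul, petz]

/-- Below the relative entropy there is a Petz quasi-entropy with the corresponding exponent. -/
lemma exists_petz_lt {ρ σ : Matrix X X ℂ} (hρ : IsDensity ρ) (hσ : 0 ≤ σ) {R : ℝ}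
    (hR : (R : EReal) < umegaki X ρ σ) :
    ∃ s : ℝ, 0 < s ∧ s < 1 ∧ petz s ρ σ < (2 : ℝ) ^ (-(s * R)) := by
  have hρ0 : 0 ≤ ρ := nonneg_iff_posSemidef.mpr hρ.1
  have hρH := isHermitian_of_nonneg hρ0
  have hσH := isHermitian_of_nonneg hσ
  obtain ⟨p, q, w, hp, hq, hw, htr⟩ := exists_joint_spectral hρ0 hσ
  -- `c` removes the zero eigenvalues of `σ`, where `Real.log 0 = 0` would give 1 instead of 0^s.
  -- The smooth function `h` then extends the quasi-entropy from (0,1), and `φ` compares it with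
  -- 2^(−sR).
  set c : X → ℝ := fun j => if q j = 0 then 0 else 1 with hc
  set h : ℝ → ℝ := fun s => ∑ i, ∑ j,
    w i j * (p i * c j * Real.exp (s * (Real.log (q j) - Real.log (p i)))) with hh
  set φ : ℝ → ℝ := fun s => h s - Real.exp (s * (-(R * Real.log 2))) with hφ
  have hpetz : ∀ s : ℝ, 0 < s → s < 1 → petz s ρ σ = h s := by
    intro s hs0 hs1
    rw [petz, htr]
    refine Finset.sum_congr rfl fun i _ => Finset.sum_congr rfl fun j _ => ?_
    congr 1
    simp only [hc]
    rcases (hp i).eq_or_lt with hi | hi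
    · rw [← hi, Real.zero_rpow (by linarith)]; simp
    · rcases (hq j).eq_or_lt with hj | hj
      · rw [← hj, Real.zero_rpow (by linarith)]; simp
      · rw [if_neg hj.ne', Real.rpow_def_of_pos hi, Real.rpow_def_of_pos hj, mul_one]
        nth_rw 2 [← Real.exp_log hi]
        rw [← Real.exp_add, ← Real.exp_add]
        congr 1
        ring
  have hderiv : HasDerivAt φ (∑ i, ∑ j, w i j * (p i * c j * (Real.log (q j) - Real.log (p i)))
      - -(R * Real.log 2)) 0 := by
    have e : ∀ a : ℝ, HasDerivAt (fun s : ℝ => Real.exp (s * a)) a 0 := by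
      intro a
      simpa using ((hasDerivAt_id (0 : ℝ)).mul_const a).exp
    refine HasDerivAt.sub ?_ (e _)
    refine HasDerivAt.fun_sum fun i _ => HasDerivAt.fun_sum fun j _ => ?_
    exact ((e _).const_mul _).const_mul _
  have h1 : ∑ i, ∑ j, w i j * p i = 1 := by
    have := htr (fun x => x) (fun _ => 1)
    rw [cfc_self hρH, cfc_one_eq hσH, Matrix.mul_one, hρ.2, Complex.one_re] at this
    simpa using this.symm
  have hk : (ρ * kerProj σ).trace.re = ∑ i, ∑ j, w i j * (p i * (1 - c j)) := by
    have := htr (fun x => x) (fun x => if x = 0 then 1 else 0)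
    rw [cfc_self hρH] at this
    rw [kerProj, this]
    refine Finset.sum_congr rfl fun i _ => Finset.sum_congr rfl fun j _ => ?_
    simp only [hc]
    split_ifs <;> simp
  have hφ0 : φ 0 = -(ρ * kerProj σ).trace.re := by
    rw [hk]
    simp only [hφ, hh, zero_mul, Real.exp_zero, mul_one]
    simp only [mul_sub, mul_one, Finset.sum_sub_distrib, h1]
    ring
  -- For nested supports φ(0) = 0 and φ'(0) = (R − D) ln 2 < 0. Otherwise φ(0) = −tr(ρ · kerProj σ)
  -- is already negative and continuity suffices.
  have hev : ∀ᶠ s in 𝓝[>] (0 : ℝ), φ s < 0 := by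
    by_cases hs : supp ρ ≤ supp σ
    · have hker := (supp_le_supp_iff hσH).mp hs
      have hk0 : (ρ * kerProj σ).trace.re = 0 := by
        rw [trace_mul_comm, hker, trace_zero, Complex.zero_re]
      rw [umegaki, if_pos hs, EReal.coe_lt_coe_iff] at hR
      have hD : (ρ * (cfc (Real.logb 2) ρ - cfc (Real.logb 2) σ)).trace.re * Real.log 2
          = -∑ i, ∑ j, w i j * (p i * c j * (Real.log (q j) - Real.log (p i))) := by
        have e1 := htr (fun x => x * Real.logb 2 x) (fun _ => 1)
        have e2 := htr (fun x => x) (Real.logb 2)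
        rw [← cfc_mul_cfc, cfc_self hρH, cfc_one_eq hσH, Matrix.mul_one] at e1
        rw [cfc_self hρH] at e2
        have hz : ∀ i j, w i j * (p i * (1 - c j)) = 0 := by
          have hnn : ∀ i j, 0 ≤ w i j * (p i * (1 - c j)) := fun i j => by
            refine mul_nonneg (hw i j) (mul_nonneg (hp i) ?_)
            simp only [hc]; split_ifs <;> norm_num
          rw [hk, Finset.sum_eq_zero_iff_of_nonneg
            fun i _ => Finset.sum_nonneg fun j _ => hnn i j] at hk0
          intro i j
          exact (Finset.sum_eq_zero_iff_of_nonneg fun j _ => hnn i j).mp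
            (hk0 i (Finset.mem_univ i)) j (Finset.mem_univ j)
        rw [Matrix.mul_sub, trace_sub, Complex.sub_re, e1, e2, ← Finset.sum_sub_distrib,
          Finset.sum_mul, ← Finset.sum_neg_distrib]
        refine Finset.sum_congr rfl fun i _ => ?_
        rw [← Finset.sum_sub_distrib, Finset.sum_mul, ← Finset.sum_neg_distrib]
        refine Finset.sum_congr rfl fun j _ => ?_
        have hl : Real.log 2 ≠ 0 := (Real.log_pos one_lt_two).ne'
        simp only [Real.logb]
        field_simp
        linear_combination (Real.log (p i) - Real.log (q j)) * hz i j
      have hneg : ∑ i, ∑ j, w i j * (p i * c j * (Real.log (q j) - Real.log (p i)))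
          - -(R * Real.log 2) < 0 := by
        have := mul_lt_mul_of_pos_right hR (Real.log_pos one_lt_two)
        linarith
      have hsl := (hasDerivAt_iff_tendsto_slope.mp hderiv).eventually (gt_mem_nhds hneg)
      have hsl' : ∀ᶠ s in 𝓝[>] (0 : ℝ), slope φ 0 s < 0 :=
        hsl.filter_mono (nhdsWithin_mono _ fun x hx => ne_of_gt hx)
      filter_upwards [hsl', self_mem_nhdsWithin] with s hs1 hs2
      have hs2 : (0 : ℝ) < s := hs2
      rw [slope_def_field, hφ0, hk0, sub_zero, neg_zero, sub_zero, div_lt_iff₀ hs2, zero_mul] at hs1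
      exact hs1
    · have hne : (ρ * kerProj σ).trace.re ≠ 0 := fun h0 =>
        hs ((supp_le_supp_iff hσH).mpr (kerProj_mul_eq_zero_of_trace hρ0 h0))
      have hpos : 0 < (ρ * kerProj σ).trace.re :=
        lt_of_le_of_ne (re_trace_mul_nonneg hρ0 (kerProj_nonneg _)) hne.symm
      have : φ 0 < 0 := by rw [hφ0]; linarith
      exact (hderiv.continuousAt.eventually (gt_mem_nhds this)).filter_mono nhdsWithin_le_nhds
  obtain ⟨s, hs, hs0, hs1⟩ :=
    (hev.and (Ioo_mem_nhdsGT (zero_lt_one' ℝ))).exists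
  refine ⟨s, hs0, hs1, ?_⟩
  rw [hpetz s hs0 hs1, Real.rpow_def_of_pos two_pos]
  have : Real.log 2 * -(s * R) = s * -(R * Real.log 2) := by ring
  rw [this]
  exact sub_neg.mp hs

end Spectral

/-! ### Tensor powers of channels. -/

section ChannelPowers

variable {A : Type u} {B : Type v} [Fintype A] [DecidableEq A] [Fintype B] [DecidableEq B]
  {N M : Matrix A A ℂ →ₗ[ℂ] Matrix B B ℂ}

/-- Up to reordering, the Choi matrix is the output on the unnormalized maximally entangled vector
`v`, with a copy of `A` as reference. -/
lemma choi_nonneg (hN : IsCPTP N) : 0 ≤ choi N := by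
  let e := Fintype.equivFin A
  let v : Fin (Fintype.card A) × A → ℂ := fun x => if x.1 = e x.2 then 1 else 0
  have h := hN.1 _ _ (posSemidef_vecMulVec_self_star v)
  rw [nonneg_iff_posSemidef]
  have key : choi N = (idTensor (Fin (Fintype.card A)) N (vecMulVec v (star v))).submatrix
      (fun x : B × A => (e x.2, x.1)) (fun x : B × A => (e x.2, x.1)) := ?_
  · rw [key]
    exact h.submatrix _
  ext x y
  simp only [choi, idTensor, of_apply, submatrix_apply]
  have hs : single x.2 y.2 (1 : ℂ)
      = of fun a a' => vecMulVec v (star v) (e x.2, a) (e y.2, a') := ?_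
  · rw [hs]
  ext a a'
  simp only [single_apply, of_apply, vecMulVec_apply, v, Pi.star_apply, EmbeddingLike.apply_eq_iff_eq]
  split_ifs <;> simp_all

lemma exists_kraus (hN : IsCPTP N) :
    ∃ (m : ℕ) (K : Fin m → Matrix B A ℂ), ∀ a a' b b',
      N (single a a' 1) b b' = ∑ k, K k b a * star (K k b' a') := by
  obtain ⟨C, hC⟩ := exists_eq_mul_conjTranspose (choi_nonneg hN)
  let e := Fintype.equivFin (B × A)
  refine ⟨_, fun k => of fun b a => C (b, a) (e.symm k), fun a a' b b' => ?_⟩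
  have := congrFun (congrFun hC (b, a)) (b', a')
  rw [Matrix.mul_apply, ← e.symm.sum_comp] at this
  simpa [choi] using this

/-- Tensor products of Kraus operators of `N` are Kraus operators of its tensor power. -/
lemma idTensor_tensorPow_nonneg (hN : IsCPTP N) (d n : ℕ)
    {Y : Matrix (Fin d × (Fin n → A)) (Fin d × (Fin n → A)) ℂ} (hY : 0 ≤ Y) :
    0 ≤ idTensor (Fin d) (tensorPow N n) Y := by
  obtain ⟨m, K, hK⟩ := exists_kraus hN
  let L : (Fin n → Fin m) → Matrix (Fin d × (Fin n → B)) (Fin d × (Fin n → A)) ℂ := fun κ =>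
    (1 : Matrix (Fin d) (Fin d) ℂ) ⊗ₖ of fun b a => ∏ i, K (κ i) (b i) (a i)
  have key : idTensor (Fin d) (tensorPow N n) Y = ∑ κ, L κ * Y * (L κ)ᴴ := by
    ext ⟨r, b⟩ ⟨r', b'⟩
    simp only [idTensor, tensorPow, LinearMap.coe_mk, AddHom.coe_mk, of_apply, hK,
      Finset.prod_univ_sum, Fintype.piFinset_univ, Matrix.sum_apply, Matrix.mul_apply,
      Fintype.sum_prod_type, L, kroneckerMap_apply, one_apply, conjTranspose_apply, ite_mul,
      zero_mul, one_mul, Finset.sum_mul, Finset.mul_sum, apply_ite star, star_zero, mul_ite,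
      mul_zero, Finset.prod_mul_distrib, star_prod]
    simp only [Finset.sum_ite_irrel, Finset.sum_const_zero, Finset.sum_ite_eq, Finset.mem_univ,
      if_true]
    rw [Finset.sum_comm_cycle]
    refine Finset.sum_congr rfl fun κ _ => ?_
    rw [Finset.sum_comm]
    exact Finset.sum_congr rfl fun a _ => Finset.sum_congr rfl fun a' _ => by ring
  rw [key]
  refine Finset.sum_nonneg fun κ _ => ?_
  rw [nonneg_iff_posSemidef]
  exact (nonneg_iff_posSemidef.mp hY).mul_mul_conjTranspose_same (L κ)

/-- On matrix units the sum over outputs factorizes into the traces of `N` on single-system units,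
which are Kronecker deltas. -/
lemma trace_idTensor_tensorPow (hN : IsCPTP N) (d n : ℕ)
    (Y : Matrix (Fin d × (Fin n → A)) (Fin d × (Fin n → A)) ℂ) :
    (idTensor (Fin d) (tensorPow N n) Y).trace = Y.trace := by
  have h1 : ∀ a a', ∑ b, N (single a a' 1) b b = if a = a' then 1 else 0 := by
    intro a a'
    have := hN.2 (single a a' 1)
    rw [trace] at this
    simp only [diag_apply] at this
    rw [this]
    split_ifs with h
    · rw [h, trace_single_eq_same]
    · rw [trace_single_eq_of_ne _ _ _ h]
  simp only [trace, diag_apply, Fintype.sum_prod_type]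
  refine Finset.sum_congr rfl fun r _ => ?_
  simp only [idTensor, tensorPow, LinearMap.coe_mk, AddHom.coe_mk, of_apply]
  rw [Finset.sum_comm]
  refine Finset.sum_congr rfl fun a _ => ?_
  rw [Finset.sum_comm]
  have h2 : ∀ a' : Fin n → A, ∑ b : Fin n → B, ∏ i, N (single (a i) (a' i) 1) (b i) (b i)
      = if a = a' then 1 else 0 := by
    intro a'
    have := Finset.prod_univ_sum (t := fun _ : Fin n => (Finset.univ : Finset B))
      (f := fun i x => N (single (a i) (a' i) 1) x x)
    rw [Fintype.piFinset_univ] at this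
    rw [← this]
    simp only [h1]
    rw [Finset.prod_ite_zero]
    simp [funext_iff]
  simp only [← Finset.mul_sum, h2]
  simp

lemma isDensity_output (hN : IsCPTP N) {d n : ℕ}
    {ψ : Matrix (Fin d × (Fin n → A)) (Fin d × (Fin n → A)) ℂ} (hψ : IsDensity ψ) :
    IsDensity (idTensor (Fin d) (tensorPow N n) ψ) :=
  ⟨nonneg_iff_posSemidef.mp
    (idTensor_tensorPow_nonneg hN d n (nonneg_iff_posSemidef.mpr hψ.1)),
    (trace_idTensor_tensorPow hN d n ψ).trans hψ.2⟩

/-- Splitting the systems of `n + m` channel uses. -/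
def splitEquiv (C : Type*) (d₁ d₂ n m : ℕ) :
    Fin (d₁ * d₂) × (Fin (n + m) → C) ≃ (Fin d₁ × (Fin n → C)) × (Fin d₂ × (Fin m → C)) :=
  (Equiv.prodCongr finProdFinEquiv.symm (Fin.appendEquiv n m).symm).trans
    (Equiv.prodProdProdComm _ _ _ _)

lemma idTensor_tensorPow_add (d₁ d₂ n m : ℕ)
    (ψ₁ : Matrix (Fin d₁ × (Fin n → A)) (Fin d₁ × (Fin n → A)) ℂ)
    (ψ₂ : Matrix (Fin d₂ × (Fin m → A)) (Fin d₂ × (Fin m → A)) ℂ) :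
    idTensor (Fin (d₁ * d₂)) (tensorPow N (n + m))
        ((ψ₁ ⊗ₖ ψ₂).submatrix (splitEquiv A d₁ d₂ n m) (splitEquiv A d₁ d₂ n m))
      = (idTensor (Fin d₁) (tensorPow N n) ψ₁ ⊗ₖ idTensor (Fin d₂) (tensorPow N m) ψ₂).submatrix
          (splitEquiv B d₁ d₂ n m) (splitEquiv B d₁ d₂ n m) := by
  ext ⟨r, b⟩ ⟨r', b'⟩
  obtain ⟨⟨b₁, b₂⟩, rfl⟩ := (Fin.appendEquiv n m).surjective b
  obtain ⟨⟨b₁', b₂'⟩, rfl⟩ := (Fin.appendEquiv n m).surjective b'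
  simp only [idTensor, tensorPow, LinearMap.coe_mk, AddHom.coe_mk, of_apply, submatrix_apply,
    splitEquiv, Equiv.trans_apply, Equiv.prodCongr_apply, Prod.map, Equiv.symm_apply_apply,
    Equiv.prodProdProdComm_apply, kroneckerMap_apply]
  rw [← (Fin.appendEquiv n m).sum_comp]
  simp_rw [← (Fin.appendEquiv n m).sum_comp (fun a' : Fin (n + m) → A => _ * ∏ i, _)]
  simp only [Equiv.symm_apply_apply]
  simp only [Fintype.sum_prod_type, Fin.prod_univ_add, Fin.appendEquiv,
    Equiv.coe_fn_mk, Fin.append_left, Fin.append_right]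
  rw [Finset.sum_mul_sum]
  refine Finset.sum_congr rfl fun a₁ _ => Finset.sum_congr rfl fun a₂ _ => ?_
  rw [Finset.sum_mul_sum]
  exact Finset.sum_congr rfl fun a₁' _ => Finset.sum_congr rfl fun a₂' _ => by ring

end ChannelPowers

/-! ### One-shot bounds through the positive part. -/

section StateBounds

variable {X : Type u} [Fintype X] [DecidableEq X] {ρ σ : Matrix X X ℂ} {ε γ γ' : ℝ}

lemma IsDensity.nonneg (hρ : IsDensity ρ) : 0 ≤ ρ :=
  nonneg_iff_posSemidef.mpr hρ.1

lemma smul_nonneg_of_density (hσ : IsDensity σ) (γ : ℝ) : 0 ≤ (2 : ℝ) ^ γ • σ :=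
  smul_nonneg (Real.rpow_nonneg two_pos.le γ) hσ.nonneg

lemma isHermitian_sub_smul (hρ : IsDensity ρ) (hσ : IsDensity σ) (γ : ℝ) :
    (ρ - (2 : ℝ) ^ γ • σ)ᴴ = ρ - (2 : ℝ) ^ γ • σ := by
  rw [conjTranspose_sub, isHermitian_of_nonneg hρ.nonneg,
    isHermitian_of_nonneg (smul_nonneg_of_density hσ γ)]

lemma re_trace_mul_sub_smul (T : Matrix X X ℂ) (ρ σ : Matrix X X ℂ) (γ : ℝ) :
    (T * (ρ - (2 : ℝ) ^ γ • σ)).trace.re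
      = (T * ρ).trace.re - 2 ^ γ * (T * σ).trace.re := by
  simp [Matrix.mul_sub, trace_sub, trace_smul]

lemma re_trace_posPart_antitone (hρ : IsDensity ρ) (hσ : IsDensity σ) (h : γ ≤ γ') :
    (posPart (ρ - (2 : ℝ) ^ γ' • σ)).trace.re ≤ (posPart (ρ - (2 : ℝ) ^ γ • σ)).trace.re := by
  rw [← posProj_mul_self (isHermitian_sub_smul hρ hσ γ')]
  refine le_trans ?_ (re_trace_test_le_posPart (posProj_nonneg (ρ - (2 : ℝ) ^ γ' • σ))
    (posProj_le_one _) (isHermitian_sub_smul hρ hσ γ))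
  refine re_trace_mul_mono (posProj_nonneg _) (sub_le_sub_left ?_ ρ)
  exact smul_le_smul_of_nonneg_right (Real.rpow_le_rpow_of_exponent_le one_le_two h) hσ.nonneg

lemma re_trace_test_le_one {T : Matrix X X ℂ} (hT : T ≤ 1) (hρ : IsDensity ρ) :
    (T * ρ).trace.re ≤ 1 := by
  simpa [hρ.2] using re_trace_mul_mono_left hρ.nonneg hT

/-- The complement of `projLE` also contains the kernel of Y = ρ − 2^γ σ, where `Y` contributes
nothing. The bound is the variational principle for −Y with the test `1 - posProj Y`. -/
lemma re_trace_posPart_le_compl (hρ : IsDensity ρ) (hσ : IsDensity σ) (γ : ℝ) :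
    (posPart (ρ - (2 : ℝ) ^ γ • σ)).trace.re
      ≤ ((1 - projLE ρ ((2 : ℝ) ^ γ • σ)) * (ρ - (2 : ℝ) ^ γ • σ)).trace.re := by
  set Y := ρ - (2 : ℝ) ^ γ • σ with hY
  have hYH : Yᴴ = Y := isHermitian_sub_smul hρ hσ γ
  have hYn : (-Y)ᴴ = -Y := by rw [conjTranspose_neg, hYH]
  have hP : projLE ρ ((2 : ℝ) ^ γ • σ) = posProj (-Y) := by
    rw [hY, neg_sub]; rfl
  have h1 := re_trace_test_le_posPart (T := 1 - posProj Y)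
    (sub_nonneg.mpr (posProj_le_one Y)) (sub_le_self _ (posProj_nonneg Y)) hYn
  rw [hP, ← posProj_mul_self hYH]
  rw [← posProj_mul_self hYn] at h1
  simp only [Matrix.sub_mul, Matrix.mul_neg, trace_sub, trace_neg, Matrix.one_mul, Complex.sub_re,
    Complex.neg_re] at h1 ⊢
  linarith

lemma elog2_le {x : ℝ} (h : x ≤ 2 ^ γ) : elog2 x ≤ γ := by
  rw [elog2]
  split_ifs with h0
  · exact bot_le
  · rw [EReal.coe_le_coe_iff]
    exact (Real.logb_le_iff_le_rpow one_lt_two (not_le.mp h0)).mpr h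

lemma le_elog2 {x : ℝ} (h : 2 ^ γ ≤ x) : (γ : EReal) ≤ elog2 x := by
  have h0 : 0 < x := (Real.rpow_pos_of_pos two_pos γ).trans_le h
  rw [elog2, if_neg (not_le.mpr h0), EReal.coe_le_coe_iff]
  exact (Real.le_logb_iff_rpow_le one_lt_two h0).mpr h

/-- Smoothing with τ = 2^γ σ; ε²/2 is what makes its radius at most `ε`. -/
lemma dMaxSmooth_le (hρ : IsDensity ρ) (hσ : IsDensity σ) (hε : 0 ≤ ε)
    (h : (posPart (ρ - (2 : ℝ) ^ γ • σ)).trace.re ≤ ε ^ 2 / 2) :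
    dMaxSmooth ε X ρ σ ≤ γ := by
  obtain ⟨ρ', h0, hle, htr, hdist⟩ := exists_smoothing hρ (smul_nonneg_of_density hσ γ)
  have hd : purifiedDist ρ' ρ ≤ ε := by
    refine hdist.trans ?_
    rw [Real.sqrt_le_left hε]
    linarith
  refine (iInf₂_le ρ' ⟨⟨nonneg_iff_posSemidef.mp h0, htr⟩, hd⟩).trans ?_
  have hs : supp ρ' ≤ supp σ := by
    have h1 := (supp_le_supp_iff (isHermitian_of_nonneg (smul_nonneg_of_density hσ γ))).mpr
      (kerProj_mul_eq_zero_of_le h0 hle)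
    refine h1.trans ?_
    rintro _ ⟨x, rfl⟩
    refine ⟨(2 : ℝ) ^ γ • x, ?_⟩
    simp
  rw [dMax, if_pos hs]
  refine elog2_le (csInf_le ⟨0, fun t ht => ?_⟩ hle)
  have h2 := re_trace_mono (h0.trans (show ρ' ≤ t • σ from ht))
  simpa [trace_smul, hσ.2] using h2

/-- The positive-part projector `T` captures almost all of `ρ`, while tr Tσ ≤ 2^(−γ). If ρ' ≤ tσ
then tr Tρ' ≤ t 2^(−γ), yet closeness to `ρ` keeps the fidelity, and hence this weight, bounded
below. -/
lemma le_dMaxSmooth (hρ : IsDensity ρ) (hσ : IsDensity σ) (hε0 : 0 ≤ ε) (hε1 : ε < 1)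
    (h : 1 - (1 - ε ^ 2) / 4 ≤ (posPart (ρ - (2 : ℝ) ^ γ • σ)).trace.re)
    (hγ : (2 : ℝ) ^ γ' ≤ (1 - ε ^ 2) / 4 * 2 ^ γ) :
    γ' ≤ dMaxSmooth ε X ρ σ := by
  refine le_iInf₂ fun ρ' ⟨⟨hp, htr⟩, hd⟩ => ?_
  have h0 : 0 ≤ ρ' := nonneg_iff_posSemidef.mpr hp
  rw [dMax]
  split_ifs with hs
  swap
  · exact le_top
  have hne : {t : ℝ | (t • σ - ρ').PosSemidef}.Nonempty :=
    exists_smul_ge h0 hσ.nonneg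
      ((supp_le_supp_iff (isHermitian_of_nonneg hσ.nonneg)).mp hs)
  refine le_elog2 (hγ.trans (le_csInf hne fun t ht => ?_))
  have ht : ρ' ≤ t • σ := ht
  have h2γ : (0 : ℝ) < 2 ^ γ := Real.rpow_pos_of_pos two_pos γ
  set Y := ρ - (2 : ℝ) ^ γ • σ with hY
  have hYH : Yᴴ = Y := isHermitian_sub_smul hρ hσ γ
  set T := posProj Y with hT
  have hTT : T * T = T := by
    rw [hT, posProj, cfc_mul_cfc]
    exact cfc_congr fun x _ => by simp
  rw [← posProj_mul_self hYH, hY, re_trace_mul_sub_smul, ← hY, ← hT] at h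
  have hT0 : 0 ≤ T := posProj_nonneg Y
  have hTρ : (T * ρ).trace.re ≤ 1 := re_trace_test_le_one (posProj_le_one Y) hρ
  have hTσ : 0 ≤ (T * σ).trace.re := re_trace_mul_nonneg hT0 hσ.nonneg
  have hE : 0 < 1 - ε ^ 2 := by nlinarith
  have ht0 : 0 ≤ t := by
    have h2 := re_trace_mono (h0.trans ht)
    simpa [trace_smul, hσ.2] using h2
  have k1 : (T * ρ').trace.re ≤ t * (T * σ).trace.re := by
    simpa [trace_smul] using re_trace_mul_mono hT0 ht
  have k2 : (T * σ).trace.re * 2 ^ γ ≤ 1 := by nlinarith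
  have k3 : ((1 - T) * ρ).trace.re ≤ (1 - ε ^ 2) / 4 := by
    rw [Matrix.sub_mul, Matrix.one_mul, trace_sub, hρ.2, Complex.sub_re, Complex.one_re]
    nlinarith
  have hF : fidelity ρ' ρ = traceNorm (cfc Real.sqrt ρ' * cfc Real.sqrt ρ) := by
    simp [fidelity, hρ.2]
  have hF0 : 0 ≤ fidelity ρ' ρ := by
    rw [hF]; exact re_trace_nonneg (cfc_sqrt_conjTranspose_mul_nonneg _)
  have hF1 : √(1 - ε ^ 2) ≤ fidelity ρ' ρ := by
    rw [Real.sqrt_le_left hF0]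
    rw [purifiedDist, Real.sqrt_le_left hε0] at hd
    linarith
  have hF2 : fidelity ρ' ρ ≤ √(t * (T * σ).trace.re) + √((1 - ε ^ 2) / 4) := by
    rw [hF]
    refine (traceNorm_sqrt_le h0 hρ.nonneg hT0 hTT).trans ?_
    rw [hρ.2, Complex.one_re, Real.sqrt_one, one_mul]
    refine add_le_add (Real.sqrt_le_sqrt k1) ?_
    calc _ ≤ √((1 - ε ^ 2) / 4) * √1 := by gcongr
      _ = _ := by simp
  -- The quarter is chosen so that the part outside `T` accounts for at most half of the required
  -- fidelity √(1 − ε²).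
  have h4 : √((1 - ε ^ 2) / 4) = √(1 - ε ^ 2) / 2 := by
    rw [Real.sqrt_div hE.le, show (4 : ℝ) = 2 ^ 2 by norm_num, Real.sqrt_sq two_pos.le]
  have h5 : √((1 - ε ^ 2) / 4) ≤ √(t * (T * σ).trace.re) := by
    rw [h4] at hF2 ⊢
    linarith
  have h6 : (1 - ε ^ 2) / 4 ≤ t * (T * σ).trace.re :=
    (Real.sqrt_le_sqrt_iff (mul_nonneg ht0 hTσ)).mp h5
  calc (1 - ε ^ 2) / 4 * 2 ^ γ ≤ t * (T * σ).trace.re * 2 ^ γ := by gcongr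
    _ = t * ((T * σ).trace.re * 2 ^ γ) := by ring
    _ ≤ t * 1 := by gcongr
    _ = t := mul_one t

end StateBounds

/-- Reals are order-dense in `EReal`, so real slopes on either side of `L` suffice, infinite limits
included. -/
lemma tendsto_of_linear_bounds {F : ℕ → EReal} {L : EReal}
    (h1 : ∀ r : ℝ, (r : EReal) < L → ∀ᶠ n : ℕ in atTop, ((r * n : ℝ) : EReal) ≤ F n)
    (h2 : ∀ r : ℝ, L < (r : EReal) → ∀ᶠ n : ℕ in atTop, F n ≤ ((r * n : ℝ) : EReal)) :
    Tendsto (fun n : ℕ => ((1 / n : ℝ) : EReal) * F n) atTop (𝓝 L) := by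
  have key : ∀ (r : ℝ) (n : ℕ), 1 ≤ n → ((1 / n : ℝ) : EReal) * ((r * n : ℝ) : EReal) = r := by
    intro r n hn
    have : (n : ℝ) ≠ 0 := by positivity
    rw [← EReal.coe_mul]
    congr 1
    field_simp
  have hnn : ∀ n : ℕ, (0 : EReal) ≤ ((1 / n : ℝ) : EReal) := fun n => by
    rw [← EReal.coe_zero, EReal.coe_le_coe_iff]; positivity
  refine tendsto_order.mpr ⟨fun a ha => ?_, fun a ha => ?_⟩
  · obtain ⟨r, har, hrL⟩ := EReal.lt_iff_exists_real_btwn.mp ha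
    filter_upwards [h1 r hrL, eventually_ge_atTop 1] with n hn hn1
    refine har.trans_le ?_
    rw [← key r n hn1]
    exact mul_le_mul_of_nonneg_left hn (hnn n)
  · obtain ⟨r, hLr, hra⟩ := EReal.lt_iff_exists_real_btwn.mp ha
    filter_upwards [h2 r hLr, eventually_ge_atTop 1] with n hn hn1
    refine lt_of_le_of_lt ?_ hra
    rw [← key r n hn1]
    exact mul_le_mul_of_nonneg_left hn (hnn n)

/-! ### Asymptotic achievability, converse and the four limits. -/

section ChannelBounds

variable {A : Type u} {B : Type v} [Fintype A] [DecidableEq A] [Fintype B] [DecidableEq B]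
  {N M : Matrix A A ℂ →ₗ[ℂ] Matrix B B ℂ}

lemma exists_density (A : Type*) [Fintype A] [DecidableEq A] [Nonempty A] (n : ℕ) :
    ∃ ψ : Matrix (Fin 1 × (Fin n → A)) (Fin 1 × (Fin n → A)) ℂ, IsDensity ψ := by
  obtain ⟨a⟩ := ‹Nonempty A›
  let x : Fin 1 × (Fin n → A) := (0, fun _ => a)
  refine ⟨vecMulVec (Pi.single x 1) (star (Pi.single x 1)), posSemidef_vecMulVec_self_star _, ?_⟩
  rw [trace_vecMulVec]
  simp

/-- The Petz quasi-entropies attained by `n` parallel uses of the channels. -/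
def PetzAttained (N M : Matrix A A ℂ →ₗ[ℂ] Matrix B B ℂ) (s : ℝ) (n : ℕ) (x : ℝ) : Prop :=
  ∃ (d : ℕ) (ψ : Matrix (Fin d × (Fin n → A)) (Fin d × (Fin n → A)) ℂ), IsDensity ψ ∧
    petz s (idTensor (Fin d) (tensorPow N n) ψ) (idTensor (Fin d) (tensorPow M n) ψ) = x

lemma PetzAttained.add (hN : IsCPTP N) (hM : IsCPTP M) {s : ℝ} {n m : ℕ} {x y : ℝ}
    (hx : PetzAttained N M s n x) (hy : PetzAttained N M s m y) :
    PetzAttained N M s (n + m) (x * y) := by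
  obtain ⟨d₁, ψ₁, h₁, rfl⟩ := hx
  obtain ⟨d₂, ψ₂, h₂, rfl⟩ := hy
  refine ⟨d₁ * d₂, (ψ₁ ⊗ₖ ψ₂).submatrix (splitEquiv A d₁ d₂ n m) (splitEquiv A d₁ d₂ n m),
    ⟨(h₁.1.kronecker h₂.1).submatrix _, ?_⟩, ?_⟩
  · have : (ψ₁ ⊗ₖ ψ₂).trace = 1 := by rw [trace_kronecker, h₁.2, h₂.2, mul_one]
    rw [← this]
    exact Equiv.sum_comp (splitEquiv A d₁ d₂ n m) (fun i => (ψ₁ ⊗ₖ ψ₂) i i)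
  · have n1 := (isDensity_output hN h₁).1
    have n2 := (isDensity_output hN h₂).1
    have m1 := (isDensity_output hM h₁).1
    have m2 := (isDensity_output hM h₂).1
    rw [idTensor_tensorPow_add, idTensor_tensorPow_add,
      petz_submatrix _ (nonneg_iff_posSemidef.mpr (n1.kronecker n2))
        (nonneg_iff_posSemidef.mpr (m1.kronecker m2)),
      petz_kronecker (nonneg_iff_posSemidef.mpr n1) (nonneg_iff_posSemidef.mpr m1)
        (nonneg_iff_posSemidef.mpr n2) (nonneg_iff_posSemidef.mpr m2)]

lemma PetzAttained.pow_mul (hN : IsCPTP N) (hM : IsCPTP M) {s : ℝ} {n m : ℕ} {x y : ℝ}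
    (hx : PetzAttained N M s n x) (hy : PetzAttained N M s m y) (k : ℕ) :
    PetzAttained N M s (n * k + m) (x ^ k * y) := by
  induction k with
  | zero => simpa using hy
  | succ k ih =>
    have := hx.add hN hM ih
    rwa [← mul_assoc, ← pow_succ', ← add_assoc, add_comm n, ← mul_add_one] at this

/-- Achievability: below the regularized relative entropy, `n` parallel uses of the channels
can be distinguished with vanishing Type I error. -/
lemma eventually_exists_posPart_ge [Nonempty A] (hN : IsCPTP N) (hM : IsCPTP M) {r η : ℝ}
    (hr : (r : EReal) < regDiv umegaki N M) (hη : 0 < η) :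
    ∀ᶠ n : ℕ in atTop, ∃ (d : ℕ) (ψ : Matrix (Fin d × (Fin n → A)) (Fin d × (Fin n → A)) ℂ),
      IsDensity ψ ∧ 1 - η ≤ (posPart (idTensor (Fin d) (tensorPow N n) ψ
        - (2 : ℝ) ^ (r * n) • idTensor (Fin d) (tensorPow M n) ψ)).trace.re := by
  obtain ⟨r', hrr', hr'⟩ := EReal.lt_iff_exists_real_btwn.mp hr
  rw [EReal.coe_lt_coe_iff] at hrr'
  obtain ⟨m, hm⟩ := lt_iSup_iff.mp hr'
  obtain ⟨hm1, hm⟩ := lt_iSup_iff.mp hm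
  have hm0 : (m : ℝ) ≠ 0 := by positivity
  have hlt : ((r' * m : ℝ) : EReal) < channelDiv umegaki (tensorPow N m) (tensorPow M m) := by
    by_contra! hcon
    refine absurd hm (not_lt.mpr ?_)
    have hnn : (0 : EReal) ≤ ((1 / m : ℝ) : EReal) := by
      rw [← EReal.coe_zero, EReal.coe_le_coe_iff]; positivity
    refine (mul_le_mul_of_nonneg_left hcon hnn).trans (le_of_eq ?_)
    rw [← EReal.coe_mul]
    congr 1
    field_simp
  obtain ⟨d, hlt⟩ := lt_iSup_iff.mp hlt
  obtain ⟨ψ, hlt⟩ := lt_iSup_iff.mp hlt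
  obtain ⟨hψ, hlt⟩ := lt_iSup_iff.mp hlt
  obtain ⟨s, hs0, hs1, hs⟩ :=
    exists_petz_lt (isDensity_output hN hψ) (isDensity_output hM hψ).nonneg hlt
  set x := petz s (idTensor (Fin d) (tensorPow N m) ψ) (idTensor (Fin d) (tensorPow M m) ψ) with hx
  have hx0 : 0 ≤ x :=
    petz_nonneg (isDensity_output hN hψ).nonneg (isDensity_output hM hψ).nonneg s
  have hxa : PetzAttained N M s m x := ⟨d, ψ, hψ, rfl⟩
  -- Arbitrary inputs fill the n mod m uses left over by the blocks. Only finitely many lengths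
  -- occur, so they cost a constant; |r'| in `C` covers either sign of r'.
  have hy : ∀ j : ℕ, ∃ y, 0 ≤ y ∧ PetzAttained N M s j y := fun j => by
    obtain ⟨φ, hφ⟩ := exists_density A j
    exact ⟨_, petz_nonneg (isDensity_output hN hφ).nonneg (isDensity_output hM hφ).nonneg s,
      1, φ, hφ, rfl⟩
  choose y hy0 hya using hy
  set C : ℝ := (∑ j ∈ Finset.range m, y j) * 2 ^ (s * (|r'| * m)) with hC
  have hlim : Tendsto (fun n : ℕ => ((2 : ℝ) ^ (s * (r - r'))) ^ n * C) atTop (𝓝 0) := by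
    have h1 : (2 : ℝ) ^ (s * (r - r')) < 1 :=
      Real.rpow_lt_one_of_one_lt_of_neg one_lt_two (by nlinarith)
    simpa using (tendsto_pow_atTop_nhds_zero_of_lt_one (by positivity) h1).mul_const C
  filter_upwards [hlim.eventually (gt_mem_nhds hη)] with n hn
  have hpow := hxa.pow_mul hN hM (hya (n % m)) (n / m)
  rw [Nat.div_add_mod] at hpow
  obtain ⟨d', φ, hφ, hφx⟩ := hpow
  refine ⟨d', φ, hφ, ?_⟩
  have hρ := isDensity_output hN hφ
  have hσ := isDensity_output hM hφ
  have h := re_trace_sub_le_posPart hρ.nonneg (smul_nonneg_of_density hσ (r * n)) hs0 hs1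
  rw [← petz, petz_smul_right hσ.nonneg (by positivity), hφx, hρ.2, Complex.one_re] at h
  refine le_trans ?_ h
  have hj : n % m < m := Nat.mod_lt n hm1
  have hy1 : y (n % m) ≤ ∑ j ∈ Finset.range m, y j :=
    Finset.single_le_sum (f := y) (fun j _ => hy0 j) (Finset.mem_range.mpr hj)
  have hexp : ((2 : ℝ) ^ (r * n)) ^ s * ((2 : ℝ) ^ (-(s * (r' * m)))) ^ (n / m)
      ≤ ((2 : ℝ) ^ (s * (r - r'))) ^ n * 2 ^ (s * (|r'| * m)) := by
    rw [← Real.rpow_natCast, ← Real.rpow_natCast, ← Real.rpow_mul two_pos.le,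
      ← Real.rpow_mul two_pos.le, ← Real.rpow_mul two_pos.le, ← Real.rpow_add two_pos,
      ← Real.rpow_add two_pos]
    refine Real.rpow_le_rpow_of_exponent_le one_le_two ?_
    have hn' : (n : ℝ) = m * (n / m : ℕ) + (n % m : ℕ) := by
      exact_mod_cast (Nat.div_add_mod n m).symm
    have h1 : r' * (n % m : ℕ) ≤ |r'| * m :=
      mul_le_mul (le_abs_self r') (by exact_mod_cast hj.le) (by positivity) (abs_nonneg r')
    have h2 := mul_le_mul_of_nonneg_left h1 hs0.le
    have h3 : r * n * s + -(s * (r' * m)) * (n / m : ℕ)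
        = s * (r - r') * n + s * (r' * (n % m : ℕ)) := by
      linear_combination s * r' * hn'
    linarith
  have hfin : ((2 : ℝ) ^ (r * n)) ^ s * (x ^ (n / m) * y (n % m))
      ≤ ((2 : ℝ) ^ (s * (r - r'))) ^ n * C := by
    calc ((2 : ℝ) ^ (r * n)) ^ s * (x ^ (n / m) * y (n % m))
        ≤ ((2 : ℝ) ^ (r * n)) ^ s * (((2 : ℝ) ^ (-(s * (r' * m)))) ^ (n / m)
          * ∑ j ∈ Finset.range m, y j) := by
          have := hy0 (n % m)
          gcongr
      _ = ((2 : ℝ) ^ (r * n)) ^ s * ((2 : ℝ) ^ (-(s * (r' * m)))) ^ (n / m)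
          * ∑ j ∈ Finset.range m, y j := by ring
      _ ≤ ((2 : ℝ) ^ (s * (r - r'))) ^ n * 2 ^ (s * (|r'| * m))
          * ∑ j ∈ Finset.range m, y j :=
          mul_le_mul_of_nonneg_right hexp (Finset.sum_nonneg fun j _ => hy0 j)
      _ = ((2 : ℝ) ^ (s * (r - r'))) ^ n * C := by rw [hC]; ring
  linarith

/-- Converse: above the regularized relative entropy, the success probability of every sequence
of tests is eventually small. -/
lemma eventually_test_le [Nonempty A] (hN : IsCPTP N) (hconj : ExpStrongConverse N M) {r η : ℝ}
    (hr : regDiv umegaki N M < (r : EReal)) (hη : 0 < η) :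
    ∀ᶠ n : ℕ in atTop, ∀ (d : ℕ) (ψ : Matrix (Fin d × (Fin n → A)) (Fin d × (Fin n → A)) ℂ)
      (T : Matrix (Fin d × (Fin n → B)) (Fin d × (Fin n → B)) ℂ), IsDensity ψ → 0 ≤ T → T ≤ 1 →
      (T * idTensor (Fin d) (tensorPow M n) ψ).trace.re ≤ 2 ^ (-(r * n)) →
      (T * idTensor (Fin d) (tensorPow N n) ψ).trace.re ≤ η := by
  by_contra hcon
  -- Choose for each n a strategy violating the claim if there is one; a bound along this sequence
  -- then bounds all strategies.
  have hS : ∀ n : ℕ, ∃ S : CoherentStrategy A B n, S.typeII M ≤ 2 ^ (-(r * n)) ∧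
      ((∃ S' : CoherentStrategy A B n, S'.typeII M ≤ 2 ^ (-(r * n)) ∧ η < 1 - S'.typeI N) →
        η < 1 - S.typeI N) := by
    intro n
    by_cases h : ∃ S' : CoherentStrategy A B n, S'.typeII M ≤ 2 ^ (-(r * n)) ∧ η < 1 - S'.typeI N
    · obtain ⟨S', h1, h2⟩ := h
      exact ⟨S', h1, fun _ => h2⟩
    -- The zero test has Type II error 0, so the exponent condition holds even where no violating
    -- strategy exists.
    · obtain ⟨φ, hφ⟩ := exists_density A n
      refine ⟨⟨1, φ, hφ, 0, PosSemidef.zero, by simpa using PosSemidef.one⟩, ?_,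
        fun h' => absurd h' h⟩
      simp only [CoherentStrategy.typeII, Matrix.zero_mul, trace_zero, Complex.zero_re]
      positivity
  choose S hSII hSI using hS
  have hlim : regDiv umegaki N M <
      liminf (fun n : ℕ => (((1 / n : ℝ)) : EReal) * (-elog2 ((S n).typeII M))) atTop := by
    refine hr.trans_le (le_liminf_of_le (by isBoundedDefault) ?_)
    filter_upwards [eventually_ge_atTop 1] with n hn
    have hn0 : (n : ℝ) ≠ 0 := by positivity
    have h1 : ((r * n : ℝ) : EReal) ≤ -elog2 ((S n).typeII M) := by
      rw [EReal.le_neg, ← EReal.coe_neg]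
      exact elog2_le (hSII n)
    have hnn : (0 : EReal) ≤ ((1 / n : ℝ) : EReal) := by
      rw [← EReal.coe_zero, EReal.coe_le_coe_iff]; positivity
    refine le_trans (le_of_eq ?_) (mul_le_mul_of_nonneg_left h1 hnn)
    rw [← EReal.coe_mul]
    congr 1
    field_simp
  obtain ⟨c, hc, hev⟩ := hconj S hlim
  have hsmall : ∀ᶠ n : ℕ in atTop, (2 : ℝ) ^ (-(c * n)) < η := by
    have h1 : (2 : ℝ) ^ (-c) < 1 := Real.rpow_lt_one_of_one_lt_of_neg one_lt_two (by linarith)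
    have := tendsto_pow_atTop_nhds_zero_of_lt_one (by positivity) h1
    filter_upwards [this.eventually (gt_mem_nhds hη)] with n hn
    rwa [← neg_mul, Real.rpow_mul two_pos.le, Real.rpow_natCast]
  refine hcon ?_
  filter_upwards [hev, hsmall] with n h1 h2 d ψ T hψ hT0 hT1 hβ
  by_contra! hα
  have h3 := hSI n ⟨⟨d, ψ, hψ, T, nonneg_iff_posSemidef.mp hT0, hT1⟩, hβ, ?_⟩
  · linarith
  · simp only [CoherentStrategy.typeI, Matrix.sub_mul, Matrix.one_mul, trace_sub,
      (isDensity_output hN hψ).2, Complex.sub_re, Complex.one_re]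
    linarith

/-- Nonnegativity of tr T(ρ − 2^(rn) σ) forces the positive-part projector `T` to have Type II error
at most 2^(−rn), so the converse bounds tr Tρ. -/
lemma eventually_posPart_le [Nonempty A] (hN : IsCPTP N) (hM : IsCPTP M)
    (hconj : ExpStrongConverse N M) {r η : ℝ}
    (hr : regDiv umegaki N M < (r : EReal)) (hη : 0 < η) :
    ∀ᶠ n : ℕ in atTop, ∀ (d : ℕ) (ψ : Matrix (Fin d × (Fin n → A)) (Fin d × (Fin n → A)) ℂ),
      IsDensity ψ → (posPart (idTensor (Fin d) (tensorPow N n) ψ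
        - (2 : ℝ) ^ (r * n) • idTensor (Fin d) (tensorPow M n) ψ)).trace.re ≤ η := by
  filter_upwards [eventually_test_le hN hconj hr hη] with n hn d ψ hψ
  have hρ := isDensity_output hN hψ
  have hσ := isDensity_output hM hψ
  set ρ := idTensor (Fin d) (tensorPow N n) ψ
  set σ := idTensor (Fin d) (tensorPow M n) ψ
  set T := posProj (ρ - (2 : ℝ) ^ (r * n) • σ) with hT
  have h0 := re_trace_nonneg (posPart_nonneg (ρ - (2 : ℝ) ^ (r * n) • σ))
  have h2 : (0 : ℝ) < 2 ^ (r * n) := Real.rpow_pos_of_pos two_pos _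
  rw [← posProj_mul_self (isHermitian_sub_smul hρ hσ _), re_trace_mul_sub_smul, ← hT] at h0 ⊢
  have hT0 : 0 ≤ T := posProj_nonneg _
  have hT1 : T ≤ 1 := posProj_le_one _
  have h3 := re_trace_mul_nonneg hT0 hσ.nonneg
  have h4 := hn d ψ T hψ hT0 hT1 (by
    rw [Real.rpow_neg two_pos.le, ← one_div, le_div_iff₀ h2]
    have := re_trace_test_le_one hT1 hρ
    linarith)
  nlinarith

lemma le_channelDiv {D : StateDivergence.{v}} {n d : ℕ}
    {ψ : Matrix (Fin d × (Fin n → A)) (Fin d × (Fin n → A)) ℂ} (hψ : IsDensity ψ) {x : EReal}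
    (h : x ≤ D _ (idTensor (Fin d) (tensorPow N n) ψ) (idTensor (Fin d) (tensorPow M n) ψ)) :
    x ≤ channelDiv D (tensorPow N n) (tensorPow M n) :=
  h.trans (le_iSup_of_le d (le_iSup₂_of_le ψ hψ le_rfl))

lemma channelDiv_le {D : StateDivergence.{v}} {n : ℕ} {x : EReal}
    (h : ∀ (d : ℕ) (ψ : Matrix (Fin d × (Fin n → A)) (Fin d × (Fin n → A)) ℂ), IsDensity ψ →
      D _ (idTensor (Fin d) (tensorPow N n) ψ) (idTensor (Fin d) (tensorPow M n) ψ) ≤ x) :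
    channelDiv D (tensorPow N n) (tensorPow M n) ≤ x :=
  iSup_le fun d => iSup₂_le fun ψ hψ => h d ψ hψ

variable {ε : ℝ}

theorem tendsto_dSpecLower [Nonempty A] (hN : IsCPTP N) (hM : IsCPTP M)
    (hconj : ExpStrongConverse N M) (hε0 : 0 < ε) (hε1 : ε < 1) :
    Tendsto (fun n : ℕ => ((1 / n : ℝ) : EReal) *
      channelDiv (dSpecLower ε) (tensorPow N n) (tensorPow M n)) atTop
      (𝓝 (regDiv umegaki N M)) := by
  refine tendsto_of_linear_bounds (fun r hr => ?_) (fun r hr => ?_)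
  · filter_upwards [eventually_exists_posPart_ge hN hM hr hε0] with n ⟨d, ψ, hψ, h⟩
    refine le_channelDiv hψ ?_
    rw [dSpecLower]
    exact le_iSup₂_of_le (r * n) h le_rfl
  -- The half puts the bound strictly below the threshold 1 − ε, so no admissible γ can exceed rn.
  · filter_upwards [eventually_posPart_le hN hM hconj hr (η := (1 - ε) / 2) (by linarith)] with n hn
    refine channelDiv_le fun d ψ hψ => iSup₂_le fun γ hγ => ?_
    rw [EReal.coe_le_coe_iff]
    by_contra! hlt
    have := re_trace_posPart_antitone (isDensity_output hN hψ) (isDensity_output hM hψ) hlt.le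
    linarith [hn d ψ hψ]

theorem tendsto_dSpecUpper [Nonempty A] (hN : IsCPTP N) (hM : IsCPTP M)
    (hconj : ExpStrongConverse N M) (hε0 : 0 < ε) (hε1 : ε < 1) :
    Tendsto (fun n : ℕ => ((1 / n : ℝ) : EReal) *
      channelDiv (dSpecUpper ε) (tensorPow N n) (tensorPow M n)) atTop
      (𝓝 (regDiv umegaki N M)) := by
  refine tendsto_of_linear_bounds (fun r hr => ?_) (fun r hr => ?_)
  · filter_upwards [eventually_exists_posPart_ge hN hM hr (η := (1 - ε) / 2) (by linarith)]
      with n ⟨d, ψ, hψ, h⟩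
    refine le_channelDiv hψ (le_iInf₂ fun γ hγ => ?_)
    rw [EReal.coe_le_coe_iff]
    by_contra! hlt
    have := re_trace_posPart_antitone (isDensity_output hN hψ) (isDensity_output hM hψ) hlt.le
    linarith
  · filter_upwards [eventually_posPart_le hN hM hconj hr hε0] with n hn
    exact channelDiv_le fun d ψ hψ => iInf₂_le_of_le (r * n) (hn d ψ hψ) le_rfl

theorem tendsto_dSpec [Nonempty A] (hN : IsCPTP N) (hM : IsCPTP M)
    (hconj : ExpStrongConverse N M) (hε0 : 0 < ε) (hε1 : ε < 1) :
    Tendsto (fun n : ℕ => ((1 / n : ℝ) : EReal) *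
      channelDiv (dSpec ε) (tensorPow N n) (tensorPow M n)) atTop
      (𝓝 (regDiv umegaki N M)) := by
  refine tendsto_of_linear_bounds (fun r hr => ?_) (fun r hr => ?_)
  · filter_upwards [eventually_exists_posPart_ge hN hM hr hε0] with n ⟨d, ψ, hψ, h⟩
    have hρ := isDensity_output hN hψ
    have hσ := isDensity_output hM hψ
    refine le_channelDiv hψ ?_
    rw [dSpec]
    refine le_iSup₂_of_le (r * n) ?_ le_rfl
    have h1 := h.trans (re_trace_posPart_le_compl hρ hσ (r * n))
    have h2 : (0 : ℝ) < 2 ^ (r * n) := Real.rpow_pos_of_pos two_pos _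
    have h3 := re_trace_mul_nonneg (sub_nonneg.mpr (posProj_le_one
      ((2 : ℝ) ^ (r * n) • idTensor (Fin d) (tensorPow M n) ψ
        - idTensor (Fin d) (tensorPow N n) ψ))) hσ.nonneg
    rw [re_trace_mul_sub_smul, Matrix.sub_mul, Matrix.one_mul, trace_sub, hρ.2, Complex.sub_re,
      Complex.one_re] at h1
    change 0 ≤ ((1 - projLE (idTensor (Fin d) (tensorPow N n) ψ)
      ((2 : ℝ) ^ (r * n) • idTensor (Fin d) (tensorPow M n) ψ)) * _).trace.re at h3
    rw [trace_mul_comm]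
    nlinarith [mul_nonneg h2.le h3]
  · filter_upwards [eventually_test_le hN hconj hr (η := (1 - ε) / 2) (by linarith)] with n hn
    refine channelDiv_le fun d ψ hψ => iSup₂_le fun γ hγ => ?_
    have hρ := isDensity_output hN hψ
    have hσ := isDensity_output hM hψ
    rw [EReal.coe_le_coe_iff]
    by_contra! hlt
    set ρ := idTensor (Fin d) (tensorPow N n) ψ
    set σ := idTensor (Fin d) (tensorPow M n) ψ
    -- This test has tr Tρ ≥ 1 − ε by admissibility of γ and tr Tσ ≤ 2^(−γ) < 2^(−rn), contradicting
    -- the converse.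
    set T := 1 - projLE ρ ((2 : ℝ) ^ γ • σ) with hT
    have hT0 : 0 ≤ T := sub_nonneg.mpr (posProj_le_one _)
    have hT1 : T ≤ 1 := sub_le_self _ (posProj_nonneg _)
    have h1 := (re_trace_nonneg (posPart_nonneg _)).trans (re_trace_posPart_le_compl hρ hσ γ)
    rw [re_trace_mul_sub_smul, ← hT] at h1
    have h2 : (T * σ).trace.re ≤ 2 ^ (-(r * n)) := by
      refine le_trans ?_ (Real.rpow_le_rpow_of_exponent_le one_le_two (neg_le_neg hlt.le))
      have h3 : (0 : ℝ) < 2 ^ γ := Real.rpow_pos_of_pos two_pos _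
      rw [Real.rpow_neg two_pos.le, ← one_div, le_div_iff₀ h3]
      have := re_trace_test_le_one hT1 hρ
      linarith
    have h3 := hn d ψ T hψ hT0 hT1 h2
    rw [hT, Matrix.sub_mul, Matrix.one_mul, trace_sub, hρ.2, trace_mul_comm, Complex.sub_re,
      Complex.one_re] at h3
    linarith

theorem tendsto_dMaxSmooth [Nonempty A] (hN : IsCPTP N) (hM : IsCPTP M)
    (hconj : ExpStrongConverse N M) (hε0 : 0 < ε) (hε1 : ε < 1) :
    Tendsto (fun n : ℕ => ((1 / n : ℝ) : EReal) *
      channelDiv (dMaxSmooth ε) (tensorPow N n) (tensorPow M n)) atTop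
      (𝓝 (regDiv umegaki N M)) := by
  have hE : 0 < (1 - ε ^ 2) / 4 := by nlinarith
  refine tendsto_of_linear_bounds (fun r hr => ?_) (fun r hr => ?_)
  -- The factor 2^((r − r')n) eventually absorbs the constant (1 − ε²)/4 lost in `le_dMaxSmooth`.
  · obtain ⟨r', hrr', hr'⟩ := EReal.lt_iff_exists_real_btwn.mp hr
    rw [EReal.coe_lt_coe_iff] at hrr'
    have h1 : (2 : ℝ) ^ (r - r') < 1 :=
      Real.rpow_lt_one_of_one_lt_of_neg one_lt_two (by linarith)
    filter_upwards [eventually_exists_posPart_ge hN hM hr' hE,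
      (tendsto_pow_atTop_nhds_zero_of_lt_one (by positivity) h1).eventually (gt_mem_nhds hE)]
      with n ⟨d, ψ, hψ, h⟩ hn
    refine le_channelDiv hψ (le_dMaxSmooth (isDensity_output hN hψ) (isDensity_output hM hψ)
      hε0.le hε1 h ?_)
    rw [← Real.rpow_natCast, ← Real.rpow_mul two_pos.le] at hn
    have h2 : (2 : ℝ) ^ (r * n) = 2 ^ ((r - r') * n) * 2 ^ (r' * n) := by
      rw [← Real.rpow_add two_pos]
      congr 1
      ring
    rw [h2]
    gcongr
  · filter_upwards [eventually_posPart_le hN hM hconj hr (η := ε ^ 2 / 2) (by positivity)] with n hn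
    exact channelDiv_le fun d ψ hψ => dMaxSmooth_le (isDensity_output hN hψ)
      (isDensity_output hM hψ) hε0.le (hn d ψ hψ)

end ChannelBounds

end ChannelAEP

end

theorem mainTheorem2 {A : Type u} {B : Type v} [Fintype A] [DecidableEq A] [Nonempty A]
    [Fintype B] [DecidableEq B] [Nonempty B]
    (N M : Matrix A A ℂ →ₗ[ℂ] Matrix B B ℂ)
    (hN : ChannelAEP.IsCPTP N) (hM : ChannelAEP.IsCPTP M)
    (hpos : (ChannelAEP.choi N).PosDef)
    (hconj : ChannelAEP.ExpStrongConverse N M)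
    (ε : ℝ) (hε0 : 0 < ε) (hε1 : ε < 1)
    (D : ChannelAEP.StateDivergence.{v})
    (hD : D ∈ ({ChannelAEP.dMaxSmooth ε, ChannelAEP.dSpecLower ε, ChannelAEP.dSpecUpper ε,
      ChannelAEP.dSpec ε} : Set ChannelAEP.StateDivergence.{v})) :
    Tendsto
      (fun n : ℕ => (((1 / n : ℝ)) : EReal) *
        ChannelAEP.channelDiv D (ChannelAEP.tensorPow N n) (ChannelAEP.tensorPow M n))
      atTop (𝓝 (ChannelAEP.regDiv ChannelAEP.umegaki N M)) := by
  simp only [Set.mem_insert_iff, Set.mem_singleton_iff] at hD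
  rcases hD with rfl | rfl | rfl | rfl
  · exact ChannelAEP.tendsto_dMaxSmooth hN hM hconj hε0 hε1
  · exact ChannelAEP.tendsto_dSpecLower hN hM hconj hε0 hε1
  · exact ChannelAEP.tendsto_dSpecUpper hN hM hconj hε0 hε1
  · exact ChannelAEP.tendsto_dSpec hN hM hconj hε0 hε1
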